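/- Let $n$ be a positive integer, let $1 \le q < n$ be real, and let $K \subset \mathbb{R}^n$ be compact. The Riesz $q$-energy of $K$ is \[ V_q(K) = \inf_\mu \int_K\!\int_K |x-y|^{-q}\, d\mu(x)\, d\mu(y) \in (0,+\infty], \] where the infimum is over Borel probability measures $\mu$ on $K$ (and $V_q(\emptyset)=+\infty$). For $t>0$, $j\in\mathbb{Z}$ and $\hat y=(y,w)\in\mathbb{R}^n\times\mathbb{R}$ put $\rho_j(\hat y)=(y,\,2tj+(-1)^j w)$. The Neumann strip kernel on $\mathbb{R}^n\times(-t,t)$ is \[ G_t(\hat x,\hat y)=\sum_{j\in\mathbb{Z}}\frac{1}{|\hat x-\rho_j(\hat y)|^q}\quad (q>1), \] \[ G_t(\hat x,\hat y)=\frac{1}{|\hat x-\hat y|}+\sum_{j\ne 0}\Big(\frac{1}{|\hat x-\rho_j(\hat y)|}-\frac{1}{|2tj|}\Big)+\frac1t\big(\gamma-\log(4t)\big)\quad (q=1), \] with $\gamma$ the Euler--Mascheroni constant and $G_t=+\infty$ when $\hat x=\hat y$. For $x,y\in\mathbb{R}^n$ write $G_t(x,y)=G_t((x,0),(y,0))$;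 for $x \neq y$ this is finite and differentiable in $t>0$. The strip energy of $K$ is \[ E_K(t)=\inf_\mu\int_K\!\int_K G_t(x,y)\,d\mu(x)\,d\mu(y),\qquad t>0, \] with the infimum over Borel probability measures $\mu$ on $K$; a measure attaining it is called an equilibrium measure for $E_K(t)$. Suppose $V_q(K)<\infty$. Then $E_K(t)$ is finite for every $t>0$, there is exactly one equilibrium measure $\mu_t$ for $E_K(t)$, and $E_K$ is continuously differentiable on $(0,\infty)$ with \[ E_K'(t)=\int_K\!\int_K\frac{\partial G_t}{\partial t}(x,y)\,d\mu_t(x)\,d\mu_t(y),\qquad t>0. \] Here the diagonal $\{x=y\}$, where $\partial G_t/\partial t$ need not be defined, has $\mu_t\times\mu_t$-measure zero, and $\partial G_t/\partial t$ is $\mu_t\times\mu_t$-integrable. -/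

import Mathlib

open MeasureTheory Set
open scoped ENNReal

noncomputable section

/-- `ℝⁿ` with its Euclidean norm. -/
abbrev Space (n : ℕ) : Type := EuclideanSpace ℝ (Fin n)

/-- `ℝⁿ⁺¹ = ℝⁿ × ℝ` with its Euclidean norm; points are written `(y, w)` with height `w`. -/
abbrev SpaceUp (n : ℕ) : Type := WithLp 2 (EuclideanSpace ℝ (Fin n) × ℝ)

/-- The embedding `x ↦ (x, 0)` of `ℝⁿ` as the central hyperplane of `ℝⁿ⁺¹`. -/
def central {n : ℕ} (x : Space n) : SpaceUp n := WithLp.toLp 2 (x, 0)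

/-- The transformation `ρ_j(y, w) = (y, 2 t j + (-1)^j w)`. -/
def reflection {n : ℕ} (t : ℝ) (j : ℤ) (p : SpaceUp n) : SpaceUp n :=
  WithLp.toLp 2 (p.fst, 2 * t * (j : ℝ) + (-1 : ℝ) ^ j * p.snd)

/-- The Riesz kernel `|x - y|^{-q}`, equal to `+∞` on the diagonal (when `q > 0`). -/
def rieszKernel {X : Type*} [PseudoEMetricSpace X] (q : ℝ) (x y : X) : ℝ≥0∞ :=
  edist x y ^ (-q)

/-- The Riesz energy `V_q(K)`: the infimum of `∬ |x - y|^{-q} dμ dμ` over the Borel probability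
measures `μ` on `K`. It is `+∞` if there is no such measure, in particular for `K = ∅`. -/
def rieszEnergy {n : ℕ} (q : ℝ) (K : Set (Space n)) : ℝ≥0∞ :=
  ⨅ (μ : Measure (Space n)) (_ : IsProbabilityMeasure μ) (_ : μ Kᶜ = 0),
    ∫⁻ x, ∫⁻ y, rieszKernel q x y ∂μ ∂μ

/-- The contribution to the strip kernel of the images `ρ_j(ŷ)`, `j ≠ 0`, renormalized if `q = 1`.
It is meant for `q ≥ 1`, `t > 0` and points in the open strip `ℝⁿ × (-t, t)`; there
`x̂ ≠ ρ_j(ŷ)` for all `j ≠ 0`, and both series converge absolutely. -/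
def stripImages {n : ℕ} (q t : ℝ) (x y : SpaceUp n) : ℝ :=
  if q = 1 then
    (∑' j : {j : ℤ // j ≠ 0}, (1 / dist x (reflection t j y) - 1 / |2 * t * ((j : ℤ) : ℝ)|))
      + 1 / t * (Real.eulerMascheroniConstant - Real.log (4 * t))
  else
    ∑' j : {j : ℤ // j ≠ 0}, 1 / dist x (reflection t j y) ^ q

/-- The Neumann strip kernel `G_t(x̂, ŷ)` on the open strip `ℝⁿ × (-t, t)`, with value `+∞` on the
diagonal: the term `j = 0`, which is `|x̂ - ŷ|^{-q}`, plus the terms `j ≠ 0`. -/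
def stripKernelUp {n : ℕ} (q t : ℝ) (x y : SpaceUp n) : EReal :=
  (rieszKernel q x y : EReal) + (stripImages q t x y : EReal)

/-- The strip kernel `G_t(x, y)` at points of the central hyperplane. -/
def stripKernel {n : ℕ} (q t : ℝ) (x y : Space n) : EReal :=
  stripKernelUp q t (central x) (central y)

/-- The partial derivative `∂G_t/∂t (x, y)`. It is meaningful for `x ≠ y`, where `G_t(x, y)` is
finite. -/
def stripKernelDeriv {n : ℕ} (q t : ℝ) (x y : Space n) : ℝ :=
  deriv (fun s : ℝ => (stripKernel q s x y).toReal) t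

/-- The extended-real double integral `∬ k(x, y) dμ(x) dμ(y)`, as the integral of the positive part
minus that of the negative part (the latter is finite for kernels that are bounded below on a set
carrying the finite measure `μ`). -/
def doubleIntegral {X : Type*} [MeasurableSpace X] (k : X → X → EReal) (μ : Measure X) : EReal :=
  ((∫⁻ x, ∫⁻ y, (k x y).toENNReal ∂μ ∂μ : ℝ≥0∞) : EReal)
    - ((∫⁻ x, ∫⁻ y, (-(k x y)).toENNReal ∂μ ∂μ : ℝ≥0∞) : EReal)

/-- The strip energy `E_K(t)` of `K ⊆ ℝⁿ ≃ ℝⁿ × {0}`: the infimum of `∬ G_t dμ dμ` over the Borel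
probability measures `μ` on `K`; it is `+∞` for `K = ∅`. -/
def stripEnergy {n : ℕ} (q : ℝ) (K : Set (Space n)) (t : ℝ) : EReal :=
  ⨅ (μ : Measure (Space n)) (_ : IsProbabilityMeasure μ) (_ : μ Kᶜ = 0),
    doubleIntegral (stripKernel q t) μ

/-- `μ` is an equilibrium measure for `E_K(t)`: a Borel probability measure on `K` that attains the
minimum. -/
structure IsStripEquilibrium {n : ℕ} (q : ℝ) (K : Set (Space n)) (t : ℝ)
    (μ : Measure (Space n)) : Prop where
  isProbabilityMeasure : IsProbabilityMeasure μ
  measure_compl : μ Kᶜ = 0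
  attains : doubleIntegral (stripKernel q t) μ = stripEnergy q K t

end

/-! On the central hyperplane the image of `y` under the `j`-th reflection lies at squared distance
`|x-y|² + (2tj)²`, so `G_t(x,y) = |x-y|^{-q} + h_t(|x-y|²)`. Here the singular Riesz term does not
depend on `t`, and the image profile `h_t(u)` and its `t`-derivative are jointly continuous in `t >
0` and `u ≥ 0`. Hence the strip energy of a probability measure `ν` on `K` is `R(ν) + H_t(ν)` on the
weakly compact space of such measures: `R` is lower semicontinuous with values in `[0,∞]`, and `H`
and its `t`-derivative `H'` are jointly continuous and real. Finiteness of `V_q(K)` gives a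
competitor with `R < ∞`, so a minimizer exists (`exists_minimizer`).

Uniqueness comes from positive definiteness. A Riesz kernel is a mixture of Gaussians, and the
Gaussian energy of `μ - ν` is a weighted `L²` norm of the difference of characteristic functions;
thus `R` is strictly positive definite (`eq_of_lintegral_shiftedRiesz_le`). Up to additive
constants, `h_t` is a sum of regularized Riesz kernels, so `H_t` is positive semidefinite on
differences of probability measures (`two_mul_integral_imageProfile_le`). Comparing two minimizers
with their midpoint gives `eq_of_minimal`.

By compactness the unique minimizer `m t` depends continuously on `t` (`continuousAt_argmin`). Using
each of `m s` and `m t` as a competitor for the other's problem squeezes the difference quotient of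
the minimal value, and the derivative is `H' t (m t)` (`hasDerivAt_min_value`), which is continuous.
Finite Riesz energy makes the diagonal null, so `H'` is the integral of `∂G_t/∂t`. -/

noncomputable section

/-! ### The image profile as a C¹ function of `t` and the squared distance -/

/-- The nonzero integers, which index the reflected images. -/
abbrev ImageIndex : Type := {j : ℤ // j ≠ 0}

/-- The `j`-th term of `imageSeries`. -/
def imageTerm (q : ℝ) (j : ImageIndex) (u : ℝ) : ℝ :=
  (u + (2 * ((j : ℤ) : ℝ)) ^ 2) ^ (-q / 2) - ((2 * ((j : ℤ) : ℝ)) ^ 2) ^ (-q / 2)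

/-- The derivative of `imageTerm`. -/
def imageTermDeriv (q : ℝ) (j : ImageIndex) (u : ℝ) : ℝ :=
  (-q / 2) * (u + (2 * ((j : ℤ) : ℝ)) ^ 2) ^ (-q / 2 - 1)

/-- The renormalized sum over the images at scale `t = 1`, as a function of the squared
distance. -/
def imageSeries (q u : ℝ) : ℝ := ∑' j : ImageIndex, imageTerm q j u

/-- The derivative of `imageSeries`. -/
def imageSeriesDeriv (q u : ℝ) : ℝ := ∑' j : ImageIndex, imageTermDeriv q j u

lemma ImageIndex.one_le_sq (j : ImageIndex) : (1 : ℝ) ≤ ((j : ℤ) : ℝ) ^ 2 := by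
  have h : (1 : ℤ) ≤ (j : ℤ) ^ 2 := by
    have := j.2
    have h2 : 0 < (j : ℤ) ^ 2 := by positivity
    omega
  exact_mod_cast h

/-- Holds because `4j² - 1 ≥ j²`. Working on `u > -1` instead of `u ≥ 0` keeps `u = 0` interior, so
the derivatives below are two-sided even for coincident points. -/
lemma sq_le_add_two_mul_sq {u : ℝ} (hu : -1 < u) (j : ImageIndex) :
    ((j : ℤ) : ℝ) ^ 2 ≤ u + (2 * ((j : ℤ) : ℝ)) ^ 2 := by
  nlinarith [j.one_le_sq]

lemma hasDerivAt_imageTerm (q : ℝ) (j : ImageIndex) {u : ℝ} (hu : -1 < u) :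
    HasDerivAt (imageTerm q j) (imageTermDeriv q j u) u := by
  have hpos : 0 < u + (2 * ((j : ℤ) : ℝ)) ^ 2 := by
    linarith [sq_le_add_two_mul_sq hu j, j.one_le_sq]
  have h := (((hasDerivAt_id u).add_const ((2 * ((j : ℤ) : ℝ)) ^ 2)).rpow_const
    (p := -q / 2) (Or.inl hpos.ne')).sub_const (((2 * ((j : ℤ) : ℝ)) ^ 2) ^ (-q / 2))
  convert! h using 1
  simp [imageTermDeriv]

lemma norm_imageTermDeriv_le {q : ℝ} (hq : 1 ≤ q) (j : ImageIndex) {u : ℝ} (hu : -1 < u) :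
    ‖imageTermDeriv q j u‖ ≤ q / 2 * |((j : ℤ) : ℝ)| ^ (-(q + 2)) := by
  have h1 := j.one_le_sq
  have h2 := sq_le_add_two_mul_sq hu j
  have h3 : 0 < |((j : ℤ) : ℝ)| := by
    rw [abs_pos]; exact_mod_cast j.2
  rw [imageTermDeriv, norm_mul, Real.norm_eq_abs, Real.norm_eq_abs, abs_of_nonpos (by linarith),
    abs_of_nonneg (Real.rpow_nonneg (by linarith) _)]
  have h4 : |((j : ℤ) : ℝ)| ^ (-(q + 2)) = (((j : ℤ) : ℝ) ^ 2) ^ (-q / 2 - 1) := by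
    rw [← sq_abs, ← Real.rpow_natCast, ← Real.rpow_mul h3.le]
    congr 1; push_cast; ring
  rw [h4]
  have : (u + (2 * ((j : ℤ) : ℝ)) ^ 2) ^ (-q / 2 - 1) ≤ (((j : ℤ) : ℝ) ^ 2) ^ (-q / 2 - 1) :=
    Real.rpow_le_rpow_of_nonpos (by linarith) h2 (by linarith)
  have h5 : -(-q / 2) = q / 2 := by ring
  rw [h5]
  gcongr

lemma summable_imageTermDeriv_bound {q : ℝ} (hq : 1 ≤ q) :
    Summable fun j : ImageIndex => q / 2 * |((j : ℤ) : ℝ)| ^ (-(q + 2)) :=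
  ((Real.summable_abs_int_rpow (b := q + 2) (by linarith)).subtype _).mul_left _

lemma imageTerm_zero (q : ℝ) (j : ImageIndex) : imageTerm q j 0 = 0 := by simp [imageTerm]

/-- The derivatives have a summable bound uniform in `u > -1` and every term vanishes at `u = 0`, so
convergence spreads from that base point. Subtracting the value at `0` is what lets `q = 1` be
treated together with `q > 1`. -/
lemma summable_imageTerm {q : ℝ} (hq : 1 ≤ q) {u : ℝ} (hu : -1 < u) :
    Summable fun j : ImageIndex => imageTerm q j u :=
  summable_of_summable_hasDerivAt_of_isPreconnected (t := Ioi (-1)) (y₀ := 0)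
    (summable_imageTermDeriv_bound hq) isOpen_Ioi isPreconnected_Ioi
    (fun j _ hy => hasDerivAt_imageTerm q j hy) (fun j _ hy => norm_imageTermDeriv_le hq j hy)
    (by simp) (by simp [imageTerm_zero, summable_zero]) hu

lemma hasDerivAt_imageSeries {q : ℝ} (hq : 1 ≤ q) {u : ℝ} (hu : -1 < u) :
    HasDerivAt (imageSeries q) (imageSeriesDeriv q u) u :=
  hasDerivAt_tsum_of_isPreconnected (t := Ioi (-1)) (y₀ := 0)
    (summable_imageTermDeriv_bound hq) isOpen_Ioi isPreconnected_Ioi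
    (fun j _ hy => hasDerivAt_imageTerm q j hy) (fun j _ hy => norm_imageTermDeriv_le hq j hy)
    (by simp) (by simp [imageTerm_zero, summable_zero]) hu

lemma continuousOn_imageSeries {q : ℝ} (hq : 1 ≤ q) : ContinuousOn (imageSeries q) (Ioi (-1)) :=
  fun _ hu => (hasDerivAt_imageSeries hq hu).continuousAt.continuousWithinAt

lemma continuousOn_imageSeriesDeriv {q : ℝ} (hq : 1 ≤ q) :
    ContinuousOn (imageSeriesDeriv q) (Ioi (-1)) := by
  refine continuousOn_tsum (fun j => ?_) (summable_imageTermDeriv_bound hq)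
    (fun j u hu => norm_imageTermDeriv_le hq j hu)
  unfold imageTermDeriv
  refine continuousOn_const.mul (ContinuousOn.rpow_const (by fun_prop) fun u hu => Or.inl ?_)
  have := sq_le_add_two_mul_sq hu j
  linarith [j.one_le_sq]

/-- The additive constant in the scaled sum over the images. -/
def imageConst (q t : ℝ) : ℝ :=
  if q = 1 then Real.eulerMascheroniConstant - Real.log (4 * t)
  else ∑' j : ImageIndex, ((2 * ((j : ℤ) : ℝ)) ^ 2) ^ (-q / 2)

/-- The derivative of `imageConst` in `t`. -/
def imageConstDeriv (q t : ℝ) : ℝ := if q = 1 then -t⁻¹ else 0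

lemma hasDerivAt_imageConst (q : ℝ) {t : ℝ} (ht : 0 < t) :
    HasDerivAt (imageConst q) (imageConstDeriv q t) t := by
  by_cases h : q = 1
  · have h1 := (((hasDerivAt_id t).const_mul 4).log (by simp [ht.ne'])).const_sub
      Real.eulerMascheroniConstant
    have e : imageConst q = fun t => Real.eulerMascheroniConstant - Real.log (4 * t) := by
      ext; simp [imageConst, h]
    rw [e]
    convert! h1 using 1
    simp [imageConstDeriv, h]
    field_simp
  · have e : imageConst q = fun _ => ∑' j : ImageIndex, ((2 * ((j : ℤ) : ℝ)) ^ 2) ^ (-q / 2) := by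
      ext; simp [imageConst, h]
    rw [e, imageConstDeriv, if_neg h]
    exact hasDerivAt_const _ _

lemma continuousOn_imageConstDeriv (q : ℝ) : ContinuousOn (imageConstDeriv q) (Ioi 0) := by
  unfold imageConstDeriv
  split_ifs
  · exact (continuousOn_inv₀.mono fun t (ht : 0 < t) => ht.ne').neg
  · exact continuousOn_const

lemma continuousOn_imageConst (q : ℝ) : ContinuousOn (imageConst q) (Ioi 0) :=
  fun _ ht => (hasDerivAt_imageConst q ht).continuousAt.continuousWithinAt

/-- The contribution of the images to the strip kernel, in terms of the squared distance `u`. -/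
def imageProfile (q t u : ℝ) : ℝ := t ^ (-q) * (imageSeries q (u / t ^ 2) + imageConst q t)

/-- The derivative of `imageProfile` in `t`. -/
def imageProfileDeriv (q t u : ℝ) : ℝ :=
  -q * t ^ (-q - 1) * (imageSeries q (u / t ^ 2) + imageConst q t) +
    t ^ (-q) * (imageSeriesDeriv q (u / t ^ 2) * (-2 * u / t ^ 3) + imageConstDeriv q t)

lemma hasDerivAt_imageProfile {q : ℝ} (hq : 1 ≤ q) {t u : ℝ} (ht : 0 < t) (hu : 0 ≤ u) :
    HasDerivAt (fun s => imageProfile q s u) (imageProfileDeriv q t u) t := by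
  have h0 : -1 < u / t ^ 2 := by have : 0 ≤ u / t ^ 2 := by positivity
                                 linarith
  have h1 : HasDerivAt (fun s : ℝ => u / s ^ 2) (-2 * u / t ^ 3) t := by
    have := (hasDerivAt_const t u).fun_div (hasDerivAt_pow 2 t) (by positivity)
    convert! this using 1
    field_simp
    ring
  have h2 := HasDerivAt.comp t (hasDerivAt_imageSeries hq h0) h1
  have h3 : HasDerivAt (fun s : ℝ => s ^ (-q)) (-q * t ^ (-q - 1)) t :=
    Real.hasDerivAt_rpow_const (Or.inl ht.ne')
  exact h3.mul (h2.add (hasDerivAt_imageConst q ht))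

lemma continuousOn_imageProfile {q : ℝ} (hq : 1 ≤ q) :
    ContinuousOn (fun p : ℝ × ℝ => imageProfile q p.1 p.2) (Ioi 0 ×ˢ Ici 0) := by
  have hne : ∀ p ∈ Ioi (0 : ℝ) ×ˢ Ici (0 : ℝ), p.1 ≠ 0 := fun p hp => (mem_Ioi.1 hp.1).ne'
  have hdiv : ContinuousOn (fun p : ℝ × ℝ => p.2 / p.1 ^ 2) (Ioi 0 ×ˢ Ici 0) :=
    ContinuousOn.div (by fun_prop) (by fun_prop) fun p hp => pow_ne_zero _ (hne p hp)
  have hmaps : MapsTo (fun p : ℝ × ℝ => p.2 / p.1 ^ 2) (Ioi 0 ×ˢ Ici 0) (Ioi (-1)) := by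
    intro p hp
    have : 0 ≤ p.2 / p.1 ^ 2 := div_nonneg hp.2 (by positivity)
    simp only [mem_Ioi]; linarith
  refine ContinuousOn.mul (ContinuousOn.rpow_const (by fun_prop) fun p hp => Or.inl (hne p hp)) ?_
  refine ((continuousOn_imageSeries hq).comp hdiv hmaps).add ?_
  exact (continuousOn_imageConst q).comp continuousOn_fst (fun p hp => hp.1)

lemma continuousOn_imageProfileDeriv {q : ℝ} (hq : 1 ≤ q) :
    ContinuousOn (fun p : ℝ × ℝ => imageProfileDeriv q p.1 p.2) (Ioi 0 ×ˢ Ici 0) := by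
  have hne : ∀ p ∈ Ioi (0 : ℝ) ×ˢ Ici (0 : ℝ), p.1 ≠ 0 := fun p hp => (mem_Ioi.1 hp.1).ne'
  have hdiv : ContinuousOn (fun p : ℝ × ℝ => p.2 / p.1 ^ 2) (Ioi 0 ×ˢ Ici 0) :=
    ContinuousOn.div (by fun_prop) (by fun_prop) fun p hp => pow_ne_zero _ (hne p hp)
  have hmaps : MapsTo (fun p : ℝ × ℝ => p.2 / p.1 ^ 2) (Ioi 0 ×ˢ Ici 0) (Ioi (-1)) := by
    intro p hp
    have : 0 ≤ p.2 / p.1 ^ 2 := div_nonneg hp.2 (by positivity)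
    simp only [mem_Ioi]; linarith
  have hconst : ContinuousOn (fun p : ℝ × ℝ => imageConst q p.1) (Ioi 0 ×ˢ Ici 0) :=
    (continuousOn_imageConst q).comp continuousOn_fst (fun p hp => hp.1)
  have hconst' : ContinuousOn (fun p : ℝ × ℝ => imageConstDeriv q p.1) (Ioi 0 ×ˢ Ici 0) :=
    (continuousOn_imageConstDeriv q).comp continuousOn_fst (fun p hp => hp.1)
  have hpow : ∀ r : ℝ, ContinuousOn (fun p : ℝ × ℝ => p.1 ^ r) (Ioi 0 ×ˢ Ici 0) := fun r =>
    ContinuousOn.rpow_const (by fun_prop) fun p hp => Or.inl (hne p hp)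
  have hdiv3 : ContinuousOn (fun p : ℝ × ℝ => -2 * p.2 / p.1 ^ 3) (Ioi 0 ×ˢ Ici 0) :=
    ContinuousOn.div (by fun_prop) (by fun_prop) fun p hp => pow_ne_zero _ (hne p hp)
  exact ((continuousOn_const.mul (hpow _)).mul
    (((continuousOn_imageSeries hq).comp hdiv hmaps).add hconst)).add
    ((hpow _).mul ((((continuousOn_imageSeriesDeriv hq).comp hdiv hmaps).mul hdiv3).add hconst'))

/-! ### The strip kernel as Riesz kernel plus image profile -/

lemma dist_central_reflection {n : ℕ} (t : ℝ) (j : ℤ) (x y : Space n) :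
    dist (central x) (reflection t j (central y)) ^ 2 = dist x y ^ 2 + (2 * t * j) ^ 2 := by
  rw [WithLp.prod_dist_eq_of_L2, Real.sq_sqrt (by positivity)]
  simp [central, reflection, Real.dist_eq, mul_pow]

lemma edist_central {n : ℕ} (x y : Space n) : edist (central x) (central y) = edist x y := by
  rw [edist_dist, edist_dist, WithLp.prod_dist_eq_of_L2]
  simp [central]

lemma one_div_dist_central_reflection_rpow {n : ℕ} {q t : ℝ} (ht : 0 < t) (j : ℤ)
    (x y : Space n) :
    1 / dist (central x) (reflection t j (central y)) ^ q =
      t ^ (-q) * (dist x y ^ 2 / t ^ 2 + (2 * (j : ℝ)) ^ 2) ^ (-q / 2) := by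
  have h := dist_central_reflection t j x y
  set d := dist (central x) (reflection t j (central y)) with hd
  have hd0 : 0 ≤ d := dist_nonneg
  have h1 : d ^ q = (d ^ 2) ^ (q / 2) := by
    rw [← Real.rpow_natCast, ← Real.rpow_mul hd0]; congr 1; push_cast; ring
  have h2 : d ^ 2 = t ^ 2 * (dist x y ^ 2 / t ^ 2 + (2 * (j : ℝ)) ^ 2) := by
    rw [h]; field_simp
  rw [h1, h2, Real.mul_rpow (by positivity) (by positivity), one_div, mul_inv,
    ← Real.rpow_neg (by positivity), ← Real.rpow_neg (by positivity)]
  congr 1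
  · rw [← Real.rpow_natCast, ← Real.rpow_mul ht.le]; congr 1; push_cast; ring
  · congr 1; ring

lemma sq_two_mul_rpow (q : ℝ) (j : ImageIndex) :
    ((2 * ((j : ℤ) : ℝ)) ^ 2) ^ (-q / 2) = 2 ^ (-q) * |((j : ℤ) : ℝ)| ^ (-q) := by
  rw [← sq_abs, ← Real.rpow_natCast, ← Real.rpow_mul (abs_nonneg _), abs_mul,
    Real.mul_rpow (by positivity) (by positivity), abs_of_pos (by norm_num : (0 : ℝ) < 2)]
  have : ((2 : ℕ) : ℝ) * (-q / 2) = -q := by push_cast; ring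
  rw [this]

lemma summable_sq_two_mul_rpow {q : ℝ} (hq : 1 < q) :
    Summable fun j : ImageIndex => ((2 * ((j : ℤ) : ℝ)) ^ 2) ^ (-q / 2) := by
  simp_rw [sq_two_mul_rpow]
  exact ((Real.summable_abs_int_rpow hq).subtype _).mul_left _

/-- Scaling by `t` takes `t ^ (-q)` out of every term. For `q = 1` the subtracted terms are already
in the kernel; for `q > 1` their sum converges and is moved into `imageConst`. -/
lemma stripImages_central {n : ℕ} {q t : ℝ} (hq : 1 ≤ q) (ht : 0 < t) (x y : Space n) :
    stripImages q t (central x) (central y) = imageProfile q t (dist x y ^ 2) := by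
  have hu : -1 < dist x y ^ 2 / t ^ 2 := by
    have : 0 ≤ dist x y ^ 2 / t ^ 2 := by positivity
    linarith
  by_cases h : q = 1
  · subst h
    simp only [stripImages, imageProfile, imageConst, if_true]
    rw [mul_add]
    congr 1
    · rw [imageSeries, ← tsum_mul_left]
      congr 1
      ext j
      have h1 := one_div_dist_central_reflection_rpow (q := 1) ht j x y
      rw [Real.rpow_one] at h1
      rw [h1, imageTerm, mul_sub, sq_two_mul_rpow]
      congr 1
      have : |2 * t * ((j : ℤ) : ℝ)| = t * (2 * |((j : ℤ) : ℝ)|) := by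
        rw [abs_mul, abs_of_pos (by positivity)]; ring
      rw [this, Real.rpow_neg_one, Real.rpow_neg_one, Real.rpow_neg_one, one_div, mul_inv, mul_inv]
    · rw [Real.rpow_neg_one, one_div]
  · have hq' : 1 < q := lt_of_le_of_ne hq (Ne.symm h)
    simp only [stripImages, imageProfile, imageConst, if_neg h]
    rw [imageSeries, ← (summable_imageTerm hq hu).tsum_add (summable_sq_two_mul_rpow hq'),
      ← tsum_mul_left]
    congr 1
    ext j
    rw [one_div_dist_central_reflection_rpow ht, imageTerm, sub_add_cancel]

lemma stripKernel_eq {n : ℕ} {q t : ℝ} (hq : 1 ≤ q) (ht : 0 < t) (x y : Space n) :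
    stripKernel q t x y = (rieszKernel q x y : EReal) + (imageProfile q t (dist x y ^ 2) : ℝ) := by
  rw [stripKernel, stripKernelUp, stripImages_central hq ht, rieszKernel, edist_central,
    rieszKernel]

/-! ### Minimizing a lower semicontinuous function plus a continuous perturbation -/

open Filter Topology in
/-- Continuity of the minimizer of `R + H t` in the parameter `t`. -/
lemma continuousAt_argmin {P : Type*} [TopologicalSpace P] [CompactSpace P]
    {R : P → ℝ≥0∞} (hR : LowerSemicontinuous R) {H : ℝ → P → ℝ}
    (hH : ContinuousOn (fun z : ℝ × P => H z.1 z.2) (Ioi 0 ×ˢ univ))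
    {m : ℝ → P} (hfin : ∀ t, 0 < t → R (m t) ≠ ⊤)
    (hmin : ∀ t, 0 < t → ∀ p, R p ≠ ⊤ → (R (m t)).toReal + H t (m t) ≤ (R p).toReal + H t p)
    (huniq : ∀ t, 0 < t → ∀ p, R p ≠ ⊤ →
      (R p).toReal + H t p ≤ (R (m t)).toReal + H t (m t) → p = m t)
    {t : ℝ} (ht : 0 < t) : ContinuousAt m t := by
  have hHat : ∀ p, ContinuousAt (fun z : ℝ × P => H z.1 z.2) (t, p) := fun p =>
    hH.continuousAt ((isOpen_Ioi.prod isOpen_univ).mem_nhds ⟨ht, mem_univ _⟩)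
  rw [ContinuousAt, tendsto_iff_ultrafilter]
  intro U hU
  -- Along an ultrafilter finer than the neighbourhoods of `t`, compactness makes the minimizers
  -- converge to some `p`; it remains to show that `p` minimizes at `t`.
  obtain ⟨p, -, hp⟩ := isCompact_univ.ultrafilter_le_nhds (U.map m) (by simp)
  have hmU : Tendsto m U (𝓝 p) := hp
  have hid : Tendsto (fun s : ℝ => s) U (𝓝 t) := hU
  have hpos : ∀ᶠ s in (U : Filter ℝ), 0 < s := hU (Ioi_mem_nhds ht)
  have h1 : Tendsto (fun s => H s (m s)) U (𝓝 (H t p)) :=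
    (hHat p).tendsto.comp (hid.prodMk_nhds hmU)
  have h2 : Tendsto (fun s => H s (m t)) U (𝓝 (H t (m t))) :=
    (hHat (m t)).tendsto.comp (hid.prodMk_nhds tendsto_const_nhds)
  have h3 := (h2.const_add (R (m t)).toReal).sub h1
  set c := (R (m t)).toReal + H t (m t) - H t p
  -- Minimality of `m s` tested against `m t`. The right side tends to `c`, so lower semicontinuity
  -- gives `R p ≤ c`, that is, the value at `p` is at most the minimum.
  have hle : ∀ᶠ s in (U : Filter ℝ), (R (m s)).toReal ≤ (R (m t)).toReal + H s (m t) - H s (m s) := by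
    filter_upwards [hpos] with s hs
    linarith [hmin s hs (m t) (hfin t ht)]
  have hc0 : 0 ≤ c := ge_of_tendsto h3 (hle.mono fun s hs => ENNReal.toReal_nonneg.trans hs)
  have hRp : R p ≤ ENNReal.ofReal c := by
    refine le_of_forall_lt fun y hy => ?_
    by_contra hcon
    rw [not_lt] at hcon
    obtain ⟨z, hz1, hz2⟩ := exists_between hy
    have e2 : ∀ᶠ s in (U : Filter ℝ), z < R (m s) := hmU.eventually (hR p z hz2)
    have h4 : Tendsto (fun s => ENNReal.ofReal ((R (m t)).toReal + H s (m t) - H s (m s))) U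
      (𝓝 (ENNReal.ofReal c)) := ENNReal.tendsto_ofReal h3
    have h5 : z ≤ ENNReal.ofReal c := by
      refine ge_of_tendsto h4 ?_
      filter_upwards [e2, hle, hpos] with s hs1 hs2 hs3
      refine hs1.le.trans ?_
      rw [← ENNReal.ofReal_toReal (hfin s hs3)]
      exact ENNReal.ofReal_le_ofReal hs2
    exact absurd (hz1.trans_le (h5.trans hcon)) (lt_irrefl _)
  have hRtop : R p ≠ ⊤ := ne_top_of_le_ne_top ENNReal.ofReal_ne_top hRp
  have hRc : (R p).toReal ≤ c := ENNReal.toReal_le_of_le_ofReal hc0 hRp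
  have : p = m t := huniq t ht p hRtop (by linarith)
  rwa [this] at hmU

open Filter Topology in
/-- The envelope theorem: the minimal value of `R + H t` is differentiable in `t`, with the partial
derivative of `H` at the minimizer as its derivative. -/
lemma hasDerivAt_min_value {P : Type*} [TopologicalSpace P]
    {R : P → ℝ≥0∞} {H H' : ℝ → P → ℝ}
    (hH' : ContinuousOn (fun z : ℝ × P => H' z.1 z.2) (Ioi 0 ×ˢ univ))
    (hd : ∀ t, 0 < t → ∀ p, HasDerivAt (fun s => H s p) (H' t p) t)
    {m : ℝ → P} (hfin : ∀ t, 0 < t → R (m t) ≠ ⊤)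
    (hmin : ∀ t, 0 < t → ∀ p, R p ≠ ⊤ → (R (m t)).toReal + H t (m t) ≤ (R p).toReal + H t p)
    {t : ℝ} (ht : 0 < t) (hm : ContinuousAt m t) :
    HasDerivAt (fun s => (R (m s)).toReal + H s (m s)) (H' t (m t)) t := by
  have hat : ContinuousAt (fun z : ℝ × P => H' z.1 z.2) (t, m t) :=
    hH'.continuousAt ((isOpen_Ioi.prod isOpen_univ).mem_nhds ⟨ht, mem_univ _⟩)
  rw [hasDerivAt_iff_isLittleO, Asymptotics.isLittleO_iff]
  intro ε hε
  have hev := hat.eventually (Metric.ball_mem_nhds _ hε)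
  rw [nhds_prod_eq, eventually_prod_iff] at hev
  obtain ⟨A, hA, B, hB, hAB⟩ := hev
  obtain ⟨δ, hδ, hball⟩ := Metric.eventually_nhds_iff_ball.1 (hA.and (eventually_gt_nhds ht))
  -- Mean value inequality: one slope, `H' t (m t)`, serves every `p` near `m t` with error at most
  -- `ε |s - t|`.
  have key : ∀ p, B p → ∀ s ∈ Metric.ball t δ,
      |H s p - H t p - (s - t) * H' t (m t)| ≤ ε * |s - t| := by
    intro p hp s hs
    have := (convex_ball t δ).norm_image_sub_le_of_norm_hasDerivWithin_le
      (f := fun s => H s p - s * H' t (m t)) (f' := fun s => H' s p - 1 * H' t (m t)) (C := ε)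
      (fun r hr => ((hd r (hball r hr).2 p).sub
        ((hasDerivAt_id r).mul_const (H' t (m t)))).hasDerivWithinAt)
      (fun r hr => by
        have := hAB (hball r hr).1 hp
        rw [Real.dist_eq] at this
        simpa using this.le) (Metric.mem_ball_self hδ) hs
    simp only [Real.norm_eq_abs] at this
    convert this using 2
    ring
  filter_upwards [Metric.ball_mem_nhds t hδ, hm.eventually hB, eventually_gt_nhds ht]
    with s hs hBs hs0
  have k1 := abs_le.1 (key _ hBs s hs)
  have k2 := abs_le.1 (key _ hB.self_of_nhds s hs)
  -- `m1` bounds the increment of the minimal value above by the increment of `H` at `m t`; `m2`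
  -- bounds it below by the increment of `H` at `m s`. The terms in `R` cancel.
  have m1 := hmin s hs0 (m t) (hfin t ht)
  have m2 := hmin t ht (m s) (hfin s hs0)
  simp only [Real.norm_eq_abs, smul_eq_mul]
  rw [abs_le]
  constructor <;> linarith [k1.1, k1.2, k2.1, k2.2]

/-- A lower semicontinuous function plus a continuous one attains its minimum. -/
lemma exists_minimizer {P : Type*} [TopologicalSpace P] [CompactSpace P]
    {R : P → ℝ≥0∞} (hR : LowerSemicontinuous R) (hne : ∃ p, R p ≠ ⊤) {h : P → ℝ}
    (hh : Continuous h) :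
    ∃ p, R p ≠ ⊤ ∧ ∀ p', R p' ≠ ⊤ → (R p).toReal + h p ≤ (R p').toReal + h p' := by
  obtain ⟨p0, hp0⟩ := hne
  -- Subtracting the minimum of `h` makes the objective nonnegative, so it can be minimized in
  -- `ℝ≥0∞`.
  obtain ⟨b, -, hb⟩ := isCompact_univ.exists_isMinOn ⟨p0, mem_univ _⟩ hh.continuousOn
  have hb' : ∀ p, 0 ≤ h p - h b := fun p => sub_nonneg.2 (hb (mem_univ p))
  have hlsc : LowerSemicontinuous fun p => R p + ENNReal.ofReal (h p - h b) :=
    hR.add (ENNReal.continuous_ofReal.comp (hh.sub continuous_const)).lowerSemicontinuous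
  obtain ⟨p, -, hp⟩ := (hlsc.lowerSemicontinuousOn univ).exists_isMinOn ⟨p0, mem_univ _⟩
    isCompact_univ
  have hp' : ∀ p', R p + ENNReal.ofReal (h p - h b) ≤ R p' + ENNReal.ofReal (h p' - h b) :=
    fun p' => hp (mem_univ p')
  have hpt : R p ≠ ⊤ := ne_top_of_le_ne_top
    (ENNReal.add_ne_top.2 ⟨hp0, ENNReal.ofReal_ne_top⟩) (le_self_add.trans (hp' p0))
  refine ⟨p, hpt, fun p' hpt' => ?_⟩
  have := ENNReal.toReal_mono (ENNReal.add_ne_top.2 ⟨hpt', ENNReal.ofReal_ne_top⟩) (hp' p')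
  rw [ENNReal.toReal_add hpt ENNReal.ofReal_ne_top, ENNReal.toReal_add hpt' ENNReal.ofReal_ne_top,
    ENNReal.toReal_ofReal (hb' _), ENNReal.toReal_ofReal (hb' _)] at this
  linarith

/-! ### Strict positive definiteness of the Gaussian kernel -/

section Gaussian

open Complex
open scoped ComplexConjugate

variable {V : Type*} [NormedAddCommGroup V] [InnerProductSpace ℝ V] [FiniteDimensional ℝ V]
  [MeasurableSpace V] [BorelSpace V]

/-- The mutual Gaussian energy of two measures on the Fourier side. -/
lemma integral_gaussian_prod_eq (μ ν : Measure V) [IsFiniteMeasure μ] [IsFiniteMeasure ν]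
    {b : ℝ} (hb : 0 < b) :
    (((Real.pi / b) ^ (Module.finrank ℝ V / 2 : ℝ) *
      ∫ p : V × V, Real.exp (-(‖p.1 - p.2‖ ^ 2 / (4 * b))) ∂(μ.prod ν) : ℝ) : ℂ) =
      ∫ ξ : V, cexp (-b * ‖ξ‖ ^ 2) * (charFun μ ξ * conj (charFun ν ξ)) := by
  have hb' : 0 < (b : ℂ).re := hb
  have hint : Integrable (fun ξ : V => cexp (-b * ‖ξ‖ ^ 2)) := by
    simpa using GaussianFourier.integrable_cexp_neg_mul_sq_norm_add hb' 0 (0 : V)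
  have h1 : ∀ p : V × V, ∫ ξ : V, cexp (-b * ‖ξ‖ ^ 2) *
      cexp (((inner ℝ (p.1 - p.2) ξ : ℝ) : ℂ) * I) =
      (((Real.pi / b) ^ (Module.finrank ℝ V / 2 : ℝ) *
        Real.exp (-(‖p.1 - p.2‖ ^ 2 / (4 * b))) : ℝ) : ℂ) := by
    intro p
    have := GaussianFourier.integral_cexp_neg_mul_sq_norm_add hb' I (p.1 - p.2)
    simp_rw [← Complex.exp_add]
    simp_rw [mul_comm _ I]
    rw [this, I_sq]
    push_cast
    rw [Complex.ofReal_cpow (by positivity)]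
    push_cast
    congr 2
    ring
  -- Fubini applies: an integrable Gaussian in `ξ` times a unimodular factor, over a finite measure.
  have hmeas : Integrable (fun z : (V × V) × V => cexp (-b * ‖z.2‖ ^ 2) *
      cexp (((inner ℝ (z.1.1 - z.1.2) z.2 : ℝ) : ℂ) * I)) ((μ.prod ν).prod volume) := by
    have hi : Integrable (fun z : (V × V) × V => cexp (-b * ‖z.2‖ ^ 2))
        ((μ.prod ν).prod volume) := hint.comp_snd _
    refine hi.mul_of_top_left ?_
    refine memLp_top_of_bound (C := 1) ?_ (ae_of_all _ fun z => ?_)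
    · exact Continuous.aestronglyMeasurable (by fun_prop)
    · rw [norm_exp_ofReal_mul_I]
  calc _ = ∫ p : V × V, ∫ ξ : V, cexp (-b * ‖ξ‖ ^ 2) *
      cexp (((inner ℝ (p.1 - p.2) ξ : ℝ) : ℂ) * I) ∂volume ∂(μ.prod ν) := by
        simp_rw [h1]
        rw [integral_complex_ofReal, integral_const_mul]
    _ = ∫ ξ : V, ∫ p : V × V, cexp (-b * ‖ξ‖ ^ 2) *
      cexp (((inner ℝ (p.1 - p.2) ξ : ℝ) : ℂ) * I) ∂(μ.prod ν) := integral_integral_swap hmeas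
    _ = _ := by
        congr 1
        ext ξ
        rw [integral_const_mul]
        congr 1
        rw [← charFun_neg, charFun_apply, charFun_apply, ← integral_prod_mul]
        congr 1
        ext p
        rw [← Complex.exp_add, inner_sub_left, inner_neg_right]
        push_cast
        congr 1
        ring

/-- The Gaussian energy of `μ - ν` on the Fourier side. -/
lemma gaussian_energy_sub_eq (μ ν : Measure V) [IsFiniteMeasure μ] [IsFiniteMeasure ν]
    {b : ℝ} (hb : 0 < b) :
    (Real.pi / b) ^ (Module.finrank ℝ V / 2 : ℝ) *
      (∫ p : V × V, Real.exp (-(‖p.1 - p.2‖ ^ 2 / (4 * b))) ∂(μ.prod μ) +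
        ∫ p : V × V, Real.exp (-(‖p.1 - p.2‖ ^ 2 / (4 * b))) ∂(ν.prod ν) -
        2 * ∫ p : V × V, Real.exp (-(‖p.1 - p.2‖ ^ 2 / (4 * b))) ∂(μ.prod ν)) =
      ∫ ξ : V, Real.exp (-b * ‖ξ‖ ^ 2) * ‖charFun μ ξ - charFun ν ξ‖ ^ 2 ∧
    Integrable fun ξ : V => Real.exp (-b * ‖ξ‖ ^ 2) * ‖charFun μ ξ - charFun ν ξ‖ ^ 2 := by
  have hb' : 0 < (b : ℂ).re := hb
  have hint : Integrable (fun ξ : V => cexp (-b * ‖ξ‖ ^ 2)) := by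
    simpa using GaussianFourier.integrable_cexp_neg_mul_sq_norm_add hb' 0 (0 : V)
  have hI : ∀ (ρ σ : Measure V) [IsFiniteMeasure ρ] [IsFiniteMeasure σ],
      Integrable fun ξ : V => cexp (-b * ‖ξ‖ ^ 2) * (charFun ρ ξ * conj (charFun σ ξ)) := by
    intro ρ σ _ _
    refine hint.mul_of_top_left ?_
    refine memLp_top_of_bound (C := ρ.real univ * σ.real univ) ?_ (ae_of_all _ fun z => ?_)
    · exact (measurable_charFun.mul
        (continuous_conj.measurable.comp measurable_charFun)).aestronglyMeasurable
    · rw [norm_mul, RCLike.norm_conj]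
      exact mul_le_mul (norm_charFun_le z) (norm_charFun_le z) (norm_nonneg _) (by positivity)
  have hpt : ∀ ξ : V, ((Real.exp (-b * ‖ξ‖ ^ 2) * ‖charFun μ ξ - charFun ν ξ‖ ^ 2 : ℝ) : ℂ) =
      cexp (-b * ‖ξ‖ ^ 2) * (charFun μ ξ * conj (charFun μ ξ)) +
      cexp (-b * ‖ξ‖ ^ 2) * (charFun ν ξ * conj (charFun ν ξ)) -
      cexp (-b * ‖ξ‖ ^ 2) * (charFun μ ξ * conj (charFun ν ξ)) -
      cexp (-b * ‖ξ‖ ^ 2) * (charFun ν ξ * conj (charFun μ ξ)) := by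
    intro ξ
    push_cast
    rw [← Complex.mul_conj', map_sub]
    ring
  have hsymm : ∫ p : V × V, Real.exp (-(‖p.1 - p.2‖ ^ 2 / (4 * b))) ∂(ν.prod μ) =
      ∫ p : V × V, Real.exp (-(‖p.1 - p.2‖ ^ 2 / (4 * b))) ∂(μ.prod ν) := by
    rw [← integral_prod_swap]
    congr 1
    ext p
    simp [norm_sub_rev]
  have hIc := (((hI μ μ).add (hI ν ν)).sub (hI μ ν)).sub (hI ν μ)
  constructor
  · have hsum := (integral_congr_ae (μ := (volume : Measure V)) (ae_of_all _ hpt)).trans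
      ((integral_sub' (((hI μ μ).add (hI ν ν)).sub (hI μ ν)) (hI ν μ)).trans
      (congrArg (· - _) ((integral_sub' ((hI μ μ).add (hI ν ν)) (hI μ ν)).trans
      (congrArg (· - _) (integral_add' (hI μ μ) (hI ν ν))))))
    rw [integral_complex_ofReal, ← integral_gaussian_prod_eq μ μ hb,
      ← integral_gaussian_prod_eq ν ν hb, ← integral_gaussian_prod_eq μ ν hb,
      ← integral_gaussian_prod_eq ν μ hb, hsymm] at hsum
    rw [← Complex.ofReal_inj, hsum]
    push_cast
    ring
  · have := hIc.re
    refine this.congr (ae_of_all _ fun ξ => ?_)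
    have h := congrArg Complex.re (hpt ξ)
    rw [Complex.ofReal_re] at h
    exact h.symm

/-- Positive definiteness of the Gaussian kernel. -/
lemma two_mul_integral_gaussian_le (μ ν : Measure V) [IsFiniteMeasure μ] [IsFiniteMeasure ν]
    {s : ℝ} (hs : 0 < s) :
    2 * ∫ p : V × V, Real.exp (-(s * ‖p.1 - p.2‖ ^ 2)) ∂(μ.prod ν) ≤
      ∫ p : V × V, Real.exp (-(s * ‖p.1 - p.2‖ ^ 2)) ∂(μ.prod μ) +
        ∫ p : V × V, Real.exp (-(s * ‖p.1 - p.2‖ ^ 2)) ∂(ν.prod ν) := by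
  -- This `b` solves `1 / (4b) = s`.
  have h := (gaussian_energy_sub_eq μ ν (b := 1 / (4 * s)) (by positivity)).1
  have e : ∀ x : ℝ, x / (4 * (1 / (4 * s))) = s * x := fun x => by field_simp
  simp_rw [e] at h
  have h0 : 0 ≤ ∫ ξ : V, Real.exp (-(1 / (4 * s)) * ‖ξ‖ ^ 2) * ‖charFun μ ξ - charFun ν ξ‖ ^ 2 :=
    integral_nonneg fun ξ => by positivity
  rw [← h] at h0
  have := nonneg_of_mul_nonneg_right h0 (by positivity)
  linarith

/-- Strict positive definiteness of the Gaussian kernel. -/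
lemma eq_of_integral_gaussian_eq (μ ν : Measure V) [IsFiniteMeasure μ] [IsFiniteMeasure ν]
    {s : ℝ} (hs : 0 < s)
    (heq : 2 * ∫ p : V × V, Real.exp (-(s * ‖p.1 - p.2‖ ^ 2)) ∂(μ.prod ν) =
      ∫ p : V × V, Real.exp (-(s * ‖p.1 - p.2‖ ^ 2)) ∂(μ.prod μ) +
        ∫ p : V × V, Real.exp (-(s * ‖p.1 - p.2‖ ^ 2)) ∂(ν.prod ν)) : μ = ν := by
  obtain ⟨h, hi⟩ := gaussian_energy_sub_eq μ ν (b := 1 / (4 * s)) (by positivity)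
  have e : ∀ x : ℝ, x / (4 * (1 / (4 * s))) = s * x := fun x => by field_simp
  simp_rw [e] at h
  rw [heq, sub_self, mul_zero] at h
  have h0 := (integral_eq_zero_iff_of_nonneg (fun ξ => by positivity) hi).1 h.symm
  have hcont : ∀ ρ : Measure V, IsFiniteMeasure ρ → Continuous (charFun ρ) := by
    intro ρ _
    fun_prop
  apply Measure.ext_of_charFun
  -- The weight is positive, so the characteristic functions agree almost everywhere, and by
  -- continuity everywhere.
  refine (Continuous.ae_eq_iff_eq volume (hcont μ inferInstance) (hcont ν inferInstance)).1 ?_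
  filter_upwards [h0] with ξ hξ
  simp only [Pi.zero_apply, mul_eq_zero, Real.exp_ne_zero, false_or] at hξ
  exact sub_eq_zero.1 (norm_eq_zero.1 (pow_eq_zero_iff two_ne_zero |>.1 hξ))

end Gaussian

/-! ### Riesz kernels as mixtures of Gaussians -/

/-- The Gamma integral. At `v = 0` both sides are `∞`, since `s ^ (p - 1)` is not integrable on the
half-line; the mixture formula therefore includes the diagonal. -/
lemma lintegral_rpow_mul_exp_neg_mul {p : ℝ} (hp : 0 < p) {v : ℝ} (hv : 0 ≤ v) :
    ∫⁻ s in Ioi (0 : ℝ), ENNReal.ofReal (s ^ (p - 1)) * ENNReal.ofReal (Real.exp (-(s * v))) =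
      ENNReal.ofReal (Real.Gamma p) * ENNReal.ofReal v ^ (-p) := by
  have hΓ := Real.Gamma_pos_of_pos hp
  have hpos : ∀ s ∈ Ioi (0 : ℝ), 0 ≤ s ^ (p - 1) := fun s hs => Real.rpow_nonneg (mem_Ioi.1 hs).le _
  rcases hv.eq_or_lt with rfl | hv
  · simp only [mul_zero, neg_zero, Real.exp_zero, ENNReal.ofReal_one, mul_one, ENNReal.ofReal_zero]
    rw [ENNReal.zero_rpow_of_neg (by linarith), ENNReal.mul_top (by simpa using hΓ)]
    by_contra hne
    refine not_integrableOn_Ioi_rpow (p - 1) ⟨?_, ?_⟩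
    · exact (by fun_prop : Measurable fun s : ℝ => s ^ (p - 1)).aestronglyMeasurable
    · rw [hasFiniteIntegral_iff_norm]
      refine lt_of_le_of_lt (le_of_eq ?_) (lt_top_iff_ne_top.2 hne)
      refine setLIntegral_congr_fun measurableSet_Ioi fun s hs => ?_
      rw [Real.norm_of_nonneg (hpos s hs)]
  · have h := Real.integral_rpow_mul_exp_neg_mul_Ioi hp hv
    have hI : IntegrableOn (fun s : ℝ => s ^ (p - 1) * Real.exp (-(v * s))) (Ioi 0) := by
      -- A non-integrable function would have Bochner integral `0`, but the value in `h` is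
      -- positive.
      by_contra hne
      rw [integral_undef hne] at h
      have : 0 < (1 / v) ^ p * Real.Gamma p := by positivity
      linarith
    have h2 := ofReal_integral_eq_lintegral_ofReal hI
      ((ae_restrict_iff' measurableSet_Ioi).2 (ae_of_all _ fun s hs =>
        mul_nonneg (hpos s hs) (Real.exp_pos _).le))
    rw [h, mul_comm, ENNReal.ofReal_mul hΓ.le] at h2
    rw [ENNReal.ofReal_rpow_of_pos hv, Real.rpow_neg hv.le, ← Real.inv_rpow hv.le, ← one_div, h2]
    refine setLIntegral_congr_fun measurableSet_Ioi fun s hs => ?_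
    rw [ENNReal.ofReal_mul (hpos s hs), mul_comm s v]

section Energy

variable {V : Type*} [NormedAddCommGroup V] [InnerProductSpace ℝ V] [FiniteDimensional ℝ V]
  [MeasurableSpace V] [BorelSpace V]

/-- The regularized Riesz kernel `(|x - y|² + c) ^ (-p)`. -/
def shiftedRiesz (p c : ℝ) (z : V × V) : ℝ≥0∞ := ENNReal.ofReal (‖z.1 - z.2‖ ^ 2 + c) ^ (-p)

lemma measurable_shiftedRiesz (p c : ℝ) : Measurable (shiftedRiesz (V := V) p c) := by
  unfold shiftedRiesz
  exact (Continuous.measurable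
    (by fun_prop : Continuous fun z : V × V => ‖z.1 - z.2‖ ^ 2 + c)).ennreal_ofReal.pow_const _

/-- The mutual energy for the kernel `exp (-s (|x - y|² + c))`. -/
def gaussianEnergy (s c : ℝ) (ρ : Measure (V × V)) : ℝ≥0∞ :=
  ∫⁻ z, ENNReal.ofReal (Real.exp (-(s * (‖z.1 - z.2‖ ^ 2 + c)))) ∂ρ

lemma gaussianEnergy_eq {s : ℝ} (hs : 0 < s) (c : ℝ) (ρ : Measure (V × V)) [IsFiniteMeasure ρ] :
    gaussianEnergy s c ρ =
      ENNReal.ofReal (Real.exp (-(s * c)) * ∫ z, Real.exp (-(s * ‖z.1 - z.2‖ ^ 2)) ∂ρ) := by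
  rw [gaussianEnergy, ← integral_const_mul, ofReal_integral_eq_lintegral_ofReal]
  · congr 1
    ext z
    rw [← Real.exp_add]
    congr 2
    ring
  · refine Integrable.const_mul (Integrable.of_bound (C := 1) ?_ (ae_of_all _ fun z => ?_)) _
    · exact Continuous.aestronglyMeasurable (by fun_prop)
    · rw [Real.norm_of_nonneg (Real.exp_pos _).le, Real.exp_le_one_iff]
      have : 0 ≤ s * ‖z.1 - z.2‖ ^ 2 := by positivity
      linarith
  · exact ae_of_all _ fun z => by simp only [Pi.zero_apply]; positivity

/-- Tonelli applied to the Gamma integral: inequalities between Gaussian energies for each `s > 0`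
pass to Riesz energies, with `c = 0` the singular kernel and `c > 0` an image. -/
lemma lintegral_shiftedRiesz_eq {p : ℝ} (hp : 0 < p) {c : ℝ} (hc : 0 ≤ c)
    (ρ : Measure (V × V)) [IsFiniteMeasure ρ] :
    ENNReal.ofReal (Real.Gamma p) * ∫⁻ z, shiftedRiesz p c z ∂ρ =
      ∫⁻ s in Ioi (0 : ℝ), ENNReal.ofReal (s ^ (p - 1)) * gaussianEnergy s c ρ := by
  rw [← lintegral_const_mul _ (measurable_shiftedRiesz p c)]
  have h1 : ∀ z : V × V, ENNReal.ofReal (Real.Gamma p) * shiftedRiesz p c z =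
      ∫⁻ s in Ioi (0 : ℝ), ENNReal.ofReal (s ^ (p - 1)) *
        ENNReal.ofReal (Real.exp (-(s * (‖z.1 - z.2‖ ^ 2 + c)))) := fun z =>
    (lintegral_rpow_mul_exp_neg_mul hp (by positivity)).symm
  simp_rw [h1]
  rw [lintegral_lintegral_swap]
  · refine lintegral_congr fun s => ?_
    rw [gaussianEnergy, lintegral_const_mul]
    exact (Continuous.measurable (by fun_prop : Continuous fun z : V × V =>
      Real.exp (-(s * (‖z.1 - z.2‖ ^ 2 + c))))).ennreal_ofReal
  · have m1 : Measurable fun a : (V × V) × ℝ => ENNReal.ofReal (a.2 ^ (p - 1)) :=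
      ((by fun_prop : Measurable fun s : ℝ => s ^ (p - 1)).comp measurable_snd).ennreal_ofReal
    have m2 : Measurable fun a : (V × V) × ℝ =>
        ENNReal.ofReal (Real.exp (-(a.2 * (‖a.1.1 - a.1.2‖ ^ 2 + c)))) :=
      (Continuous.measurable (by fun_prop : Continuous fun a : (V × V) × ℝ =>
        Real.exp (-(a.2 * (‖a.1.1 - a.1.2‖ ^ 2 + c))))).ennreal_ofReal
    exact (m1.mul m2).aemeasurable

lemma measurable_gaussianEnergy (c : ℝ) (ρ : Measure (V × V)) [IsFiniteMeasure ρ] :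
    Measurable fun s => gaussianEnergy s c ρ := by
  unfold gaussianEnergy
  exact Measurable.lintegral_prod_right' (f := fun a : ℝ × (V × V) =>
    ENNReal.ofReal (Real.exp (-(a.1 * (‖a.2.1 - a.2.2‖ ^ 2 + c)))))
    (Continuous.measurable (by fun_prop : Continuous fun a : ℝ × (V × V) =>
      Real.exp (-(a.1 * (‖a.2.1 - a.2.2‖ ^ 2 + c))))).ennreal_ofReal

variable (μ ν : Measure V) [IsFiniteMeasure μ] [IsFiniteMeasure ν]

lemma two_mul_gaussianEnergy_le {s : ℝ} (hs : 0 < s) (c : ℝ) :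
    2 * gaussianEnergy s c (μ.prod ν) ≤
      gaussianEnergy s c (μ.prod μ) + gaussianEnergy s c (ν.prod ν) := by
  rw [gaussianEnergy_eq hs, gaussianEnergy_eq hs, gaussianEnergy_eq hs,
    ← ENNReal.ofReal_add (by positivity) (by positivity),
    show (2 : ℝ≥0∞) = ENNReal.ofReal 2 by simp, ← ENNReal.ofReal_mul (by norm_num)]
  refine ENNReal.ofReal_le_ofReal ?_
  have := mul_le_mul_of_nonneg_left (two_mul_integral_gaussian_le μ ν hs)
    (Real.exp_pos (-(s * c))).le
  linarith

lemma eq_of_gaussianEnergy_eq {s : ℝ} (hs : 0 < s) (c : ℝ)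
    (h : 2 * gaussianEnergy s c (μ.prod ν) =
      gaussianEnergy s c (μ.prod μ) + gaussianEnergy s c (ν.prod ν)) : μ = ν := by
  rw [gaussianEnergy_eq hs, gaussianEnergy_eq hs, gaussianEnergy_eq hs,
    ← ENNReal.ofReal_add (by positivity) (by positivity),
    show (2 : ℝ≥0∞) = ENNReal.ofReal 2 by simp, ← ENNReal.ofReal_mul (by norm_num),
    ENNReal.ofReal_eq_ofReal_iff (by positivity) (by positivity), ← mul_add, mul_left_comm] at h
  exact eq_of_integral_gaussian_eq μ ν hs (mul_left_cancel₀ (Real.exp_pos _).ne' h)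

lemma Gamma_mul_two_mul_lintegral_shiftedRiesz {p : ℝ} (hp : 0 < p) {c : ℝ} (hc : 0 ≤ c) :
    ENNReal.ofReal (Real.Gamma p) * (2 * ∫⁻ z, shiftedRiesz p c z ∂(μ.prod ν)) =
      ∫⁻ s in Ioi (0 : ℝ), ENNReal.ofReal (s ^ (p - 1)) *
        (2 * gaussianEnergy s c (μ.prod ν)) := by
  rw [mul_left_comm, lintegral_shiftedRiesz_eq hp hc, ← lintegral_const_mul' _ _ (by simp)]
  exact lintegral_congr fun s => by ring

lemma Gamma_mul_add_lintegral_shiftedRiesz {p : ℝ} (hp : 0 < p) {c : ℝ} (hc : 0 ≤ c) :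
    ENNReal.ofReal (Real.Gamma p) *
      (∫⁻ z, shiftedRiesz p c z ∂(μ.prod μ) + ∫⁻ z, shiftedRiesz p c z ∂(ν.prod ν)) =
      ∫⁻ s in Ioi (0 : ℝ), ENNReal.ofReal (s ^ (p - 1)) *
        (gaussianEnergy s c (μ.prod μ) + gaussianEnergy s c (ν.prod ν)) := by
  rw [mul_add, lintegral_shiftedRiesz_eq hp hc, lintegral_shiftedRiesz_eq hp hc,
    ← lintegral_add_left]
  · exact lintegral_congr fun s => by ring
  · exact (by fun_prop : Measurable fun s : ℝ => s ^ (p - 1)).ennreal_ofReal.mul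
      (measurable_gaussianEnergy c _)

/-- Positive definiteness of the regularized Riesz kernel. -/
lemma two_mul_lintegral_shiftedRiesz_le {p : ℝ} (hp : 0 < p) {c : ℝ} (hc : 0 ≤ c) :
    2 * ∫⁻ z, shiftedRiesz p c z ∂(μ.prod ν) ≤
      ∫⁻ z, shiftedRiesz p c z ∂(μ.prod μ) + ∫⁻ z, shiftedRiesz p c z ∂(ν.prod ν) := by
  have hΓ := Real.Gamma_pos_of_pos hp
  rw [← ENNReal.mul_le_mul_iff_right (a := ENNReal.ofReal (Real.Gamma p)) (by simpa using hΓ)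
    ENNReal.ofReal_ne_top, Gamma_mul_two_mul_lintegral_shiftedRiesz μ ν hp hc,
    Gamma_mul_add_lintegral_shiftedRiesz μ ν hp hc]
  exact setLIntegral_mono' measurableSet_Ioi fun s hs =>
    mul_le_mul_right (two_mul_gaussianEnergy_le μ ν hs c) _

/-- Strict positive definiteness of the regularized Riesz kernel. -/
lemma eq_of_lintegral_shiftedRiesz_le {p : ℝ} (hp : 0 < p) {c : ℝ} (hc : 0 ≤ c)
    (hμ : ∫⁻ z, shiftedRiesz p c z ∂(μ.prod μ) ≠ ⊤)
    (hν : ∫⁻ z, shiftedRiesz p c z ∂(ν.prod ν) ≠ ⊤)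
    (h : ∫⁻ z, shiftedRiesz p c z ∂(μ.prod μ) + ∫⁻ z, shiftedRiesz p c z ∂(ν.prod ν) ≤
      2 * ∫⁻ z, shiftedRiesz p c z ∂(μ.prod ν)) : μ = ν := by
  have h1 := mul_le_mul_right h (ENNReal.ofReal (Real.Gamma p))
  have hfin : 2 * ∫⁻ z, shiftedRiesz p c z ∂(μ.prod ν) ≠ ⊤ :=
    ne_top_of_le_ne_top (ENNReal.add_ne_top.2 ⟨hμ, hν⟩)
      (two_mul_lintegral_shiftedRiesz_le μ ν hp hc)
  have hfin2 := ENNReal.mul_ne_top (ENNReal.ofReal_ne_top (r := Real.Gamma p)) hfin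
  rw [Gamma_mul_two_mul_lintegral_shiftedRiesz μ ν hp hc] at h1 hfin2
  rw [Gamma_mul_add_lintegral_shiftedRiesz μ ν hp hc] at h1
  -- The Gaussian inequality holds for each `s`, while the finite integrals over `s` satisfy the
  -- reverse inequality; so equality holds for almost every `s`, and a single `s > 0` already forces
  -- `μ = ν`.
  have hae := ae_eq_of_ae_le_of_lintegral_le
    ((ae_restrict_iff' measurableSet_Ioi).2 (ae_of_all _ fun s hs =>
      mul_le_mul_right (two_mul_gaussianEnergy_le μ ν hs c) _)) hfin2
    (Measurable.aemeasurable ((by fun_prop : Measurable fun s : ℝ => s ^ (p - 1)).ennreal_ofReal.mul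
      ((measurable_gaussianEnergy c _).add (measurable_gaussianEnergy c _)))) h1
  have hne : (ae (volume.restrict (Ioi (0 : ℝ)))).NeBot := by
    rw [ae_neBot, Ne, Measure.restrict_eq_zero]
    simp
  obtain ⟨s, hs, hs0⟩ := (hae.and (ae_restrict_mem measurableSet_Ioi)).exists
  have hs0' : 0 < s := hs0
  refine eq_of_gaussianEnergy_eq μ ν hs0' c ?_
  exact (ENNReal.mul_right_inj (by simpa using Real.rpow_pos_of_pos hs0' _)
    ENNReal.ofReal_ne_top).1 hs

lemma integrable_rpow_neg {p : ℝ} (hp : 0 < p) {c : ℝ} (hc : 0 < c)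
    (ρ : Measure (V × V)) [IsFiniteMeasure ρ] :
    Integrable (fun z : V × V => (‖z.1 - z.2‖ ^ 2 + c) ^ (-p)) ρ := by
  refine Integrable.of_bound (C := c ^ (-p)) ?_ (ae_of_all _ fun z => ?_)
  · refine Continuous.aestronglyMeasurable
      (Continuous.rpow_const (by fun_prop) fun z => Or.inl ?_)
    positivity
  · rw [Real.norm_of_nonneg (by positivity)]
    exact Real.rpow_le_rpow_of_nonpos hc (by simp) (by linarith)

lemma lintegral_shiftedRiesz_eq_ofReal {p : ℝ} (hp : 0 < p) {c : ℝ} (hc : 0 < c)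
    (ρ : Measure (V × V)) [IsFiniteMeasure ρ] :
    ∫⁻ z, shiftedRiesz p c z ∂ρ = ENNReal.ofReal (∫ z, (‖z.1 - z.2‖ ^ 2 + c) ^ (-p) ∂ρ) := by
  rw [ofReal_integral_eq_lintegral_ofReal (integrable_rpow_neg hp hc ρ)
    (ae_of_all _ fun z => by simp only [Pi.zero_apply]; positivity)]
  refine lintegral_congr fun z => ?_
  rw [shiftedRiesz, ENNReal.ofReal_rpow_of_pos (by positivity)]

lemma two_mul_integral_rpow_neg_le {p : ℝ} (hp : 0 < p) {c : ℝ} (hc : 0 < c) :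
    2 * ∫ z : V × V, (‖z.1 - z.2‖ ^ 2 + c) ^ (-p) ∂(μ.prod ν) ≤
      ∫ z : V × V, (‖z.1 - z.2‖ ^ 2 + c) ^ (-p) ∂(μ.prod μ) +
        ∫ z : V × V, (‖z.1 - z.2‖ ^ 2 + c) ^ (-p) ∂(ν.prod ν) := by
  have hnn : ∀ ρ : Measure (V × V), 0 ≤ ∫ z : V × V, (‖z.1 - z.2‖ ^ 2 + c) ^ (-p) ∂ρ := fun ρ =>
    integral_nonneg fun z => by positivity
  have h := two_mul_lintegral_shiftedRiesz_le μ ν hp hc.le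
  rw [lintegral_shiftedRiesz_eq_ofReal hp hc, lintegral_shiftedRiesz_eq_ofReal hp hc,
    lintegral_shiftedRiesz_eq_ofReal hp hc, ← ENNReal.ofReal_add (hnn _) (hnn _),
    show (2 : ℝ≥0∞) = ENNReal.ofReal 2 by simp, ← ENNReal.ofReal_mul (by norm_num)] at h
  exact (ENNReal.ofReal_le_ofReal_iff (add_nonneg (hnn _) (hnn _))).1 h

end Energy

/-! ### Conditional positive definiteness of the image profile -/

lemma imageTerm_nonpos {q : ℝ} (hq : 1 ≤ q) (j : ImageIndex) {u : ℝ} (hu : 0 ≤ u) :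
    imageTerm q j u ≤ 0 := by
  have h1 := j.one_le_sq
  exact sub_nonpos.2 (Real.rpow_le_rpow_of_nonpos (by nlinarith) (by linarith) (by linarith))

lemma measurable_imageTerm (q : ℝ) (j : ImageIndex) : Measurable (imageTerm q j) := by
  unfold imageTerm
  fun_prop

/-- All terms have the same sign, so the series of absolute values is `-imageSeries`, and its
integrability is all that dominated convergence needs. -/
lemma hasSum_integral_imageTerm {X : Type*} [MeasurableSpace X] {ρ : Measure X} {q : ℝ}
    (hq : 1 ≤ q) {v : X → ℝ} (hv : Measurable v) (hv0 : ∀ x, 0 ≤ v x)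
    (hi : Integrable (fun x => imageSeries q (v x)) ρ) :
    HasSum (fun j : ImageIndex => ∫ x, imageTerm q j (v x) ∂ρ) (∫ x, imageSeries q (v x) ∂ρ) := by
  have hs : ∀ x, Summable fun j : ImageIndex => imageTerm q j (v x) := fun x =>
    summable_imageTerm hq (by linarith [hv0 x])
  refine hasSum_integral_of_dominated_convergence (fun j x => -imageTerm q j (v x))
    (fun j => ((measurable_imageTerm q j).comp hv).aestronglyMeasurable)
    (fun j => ae_of_all _ fun x => ?_) (ae_of_all _ fun x => (hs x).neg) ?_
    (ae_of_all _ fun x => (hs x).hasSum)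
  · rw [Real.norm_of_nonpos (imageTerm_nonpos hq j (hv0 x))]
  · simp_rw [tsum_neg]
    exact hi.neg

/-- Exhibits each term as a positive multiple of the regularized Riesz kernel with shift `(2j)² t²`,
minus a constant. -/
lemma imageTerm_div_sq (q : ℝ) (j : ImageIndex) {t u : ℝ} (ht : 0 < t) (hu : 0 ≤ u) :
    imageTerm q j (u / t ^ 2) =
      (t ^ 2) ^ (q / 2) * (u + (2 * ((j : ℤ) : ℝ)) ^ 2 * t ^ 2) ^ (-(q / 2)) -
        ((2 * ((j : ℤ) : ℝ)) ^ 2) ^ (-q / 2) := by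
  rw [imageTerm]
  congr 1
  have : u / t ^ 2 + (2 * ((j : ℤ) : ℝ)) ^ 2 =
      (t ^ 2)⁻¹ * (u + (2 * ((j : ℤ) : ℝ)) ^ 2 * t ^ 2) := by field_simp
  rw [this, Real.mul_rpow (by positivity) (by positivity), Real.inv_rpow (by positivity),
    ← Real.rpow_neg (by positivity)]
  congr 2 <;> ring

/-- The kernel of the images is conditionally positive definite. -/
lemma two_mul_integral_imageProfile_le {V : Type*} [NormedAddCommGroup V] [InnerProductSpace ℝ V]
    [FiniteDimensional ℝ V] [MeasurableSpace V] [BorelSpace V]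
    (μ ν : Measure V) [IsProbabilityMeasure μ] [IsProbabilityMeasure ν] {q t : ℝ} (hq : 1 ≤ q)
    (ht : 0 < t)
    (hμν : Integrable (fun z : V × V => imageSeries q (‖z.1 - z.2‖ ^ 2 / t ^ 2)) (μ.prod ν))
    (hμμ : Integrable (fun z : V × V => imageSeries q (‖z.1 - z.2‖ ^ 2 / t ^ 2)) (μ.prod μ))
    (hνν : Integrable (fun z : V × V => imageSeries q (‖z.1 - z.2‖ ^ 2 / t ^ 2)) (ν.prod ν)) :
    2 * ∫ z : V × V, imageProfile q t (‖z.1 - z.2‖ ^ 2) ∂(μ.prod ν) ≤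
      ∫ z : V × V, imageProfile q t (‖z.1 - z.2‖ ^ 2) ∂(μ.prod μ) +
        ∫ z : V × V, imageProfile q t (‖z.1 - z.2‖ ^ 2) ∂(ν.prod ν) := by
  have hm : Measurable fun z : V × V => ‖z.1 - z.2‖ ^ 2 / t ^ 2 :=
    Continuous.measurable (by fun_prop)
  have h0 : ∀ z : V × V, 0 ≤ ‖z.1 - z.2‖ ^ 2 / t ^ 2 := fun z => by positivity
  have hle : 2 * ∫ z : V × V, imageSeries q (‖z.1 - z.2‖ ^ 2 / t ^ 2) ∂(μ.prod ν) ≤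
      ∫ z : V × V, imageSeries q (‖z.1 - z.2‖ ^ 2 / t ^ 2) ∂(μ.prod μ) +
        ∫ z : V × V, imageSeries q (‖z.1 - z.2‖ ^ 2 / t ^ 2) ∂(ν.prod ν) := by
    refine hasSum_le (fun j => ?_) ((hasSum_integral_imageTerm hq hm h0 hμν).mul_left 2)
      ((hasSum_integral_imageTerm hq hm h0 hμμ).add (hasSum_integral_imageTerm hq hm h0 hνν))
    have hc : 0 < (2 * ((j : ℤ) : ℝ)) ^ 2 * t ^ 2 := by
      have := j.one_le_sq
      have h4 : 0 < (2 * ((j : ℤ) : ℝ)) ^ 2 := by nlinarith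
      positivity
    have hp : 0 < q / 2 := by linarith
    -- Under probability measures the subtracted constant has total weight `2` on either side of the
    -- inequality and cancels; this is why positivity is only conditional.
    have e : ∀ (ρ : Measure (V × V)) [IsProbabilityMeasure ρ],
        ∫ z : V × V, imageTerm q j (‖z.1 - z.2‖ ^ 2 / t ^ 2) ∂ρ = (t ^ 2) ^ (q / 2) *
          ∫ z : V × V, (‖z.1 - z.2‖ ^ 2 + (2 * ((j : ℤ) : ℝ)) ^ 2 * t ^ 2) ^ (-(q / 2)) ∂ρ -
          ((2 * ((j : ℤ) : ℝ)) ^ 2) ^ (-q / 2) := by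
      intro ρ _
      simp_rw [fun z : V × V => imageTerm_div_sq q j ht (sq_nonneg ‖z.1 - z.2‖)]
      rw [integral_sub ((integrable_rpow_neg hp hc ρ).const_mul _) (integrable_const _),
        integral_const_mul]
      simp
    rw [e, e, e]
    have := mul_le_mul_of_nonneg_left (two_mul_integral_rpow_neg_le μ ν hp hc)
      (by positivity : 0 ≤ (t ^ 2) ^ (q / 2))
    linarith
  have e : ∀ (ρ : Measure (V × V)) [IsProbabilityMeasure ρ],
      Integrable (fun z : V × V => imageSeries q (‖z.1 - z.2‖ ^ 2 / t ^ 2)) ρ →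
      ∫ z : V × V, imageProfile q t (‖z.1 - z.2‖ ^ 2) ∂ρ = t ^ (-q) *
        (∫ z : V × V, imageSeries q (‖z.1 - z.2‖ ^ 2 / t ^ 2) ∂ρ + imageConst q t) := by
    intro ρ _ hρ
    simp_rw [imageProfile]
    rw [integral_const_mul, integral_add hρ (integrable_const _)]
    simp
  rw [e _ hμν, e _ hμμ, e _ hνν]
  have := mul_le_mul_of_nonneg_left hle (by positivity : 0 ≤ t ^ (-q))
  linarith

/-! ### Integrals depending on a parameter and a weakly varying measure -/

section CompactParam

variable {X : Type*} [TopologicalSpace X] [CompactSpace X] [MeasurableSpace X]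
  [OpensMeasurableSpace X]

open Filter Topology in
/-- The integral is jointly continuous in the integrand and the measure. -/
lemma continuous_integral_continuousMap_probabilityMeasure :
    Continuous fun z : C(X, ℝ) × ProbabilityMeasure X => ∫ x, z.1 x ∂(z.2 : Measure X) := by
  have hint : ∀ (g : C(X, ℝ)) (μ : ProbabilityMeasure X), Integrable g (μ : Measure X) :=
    fun g μ => Integrable.of_bound (C := ‖g‖) g.continuous.measurable.aestronglyMeasurable
      (ae_of_all _ g.norm_coe_le_norm)
  refine continuous_iff_continuousAt.2 fun ⟨g₀, μ₀⟩ => ?_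
  -- Split `g = g₀ + (g - g₀)`: the first integral is weakly continuous in the measure, the second
  -- is at most `‖g - g₀‖`.
  have h1 : Tendsto (fun z : C(X, ℝ) × ProbabilityMeasure X => ∫ x, g₀ x ∂(z.2 : Measure X))
      (𝓝 (g₀, μ₀)) (𝓝 (∫ x, g₀ x ∂(μ₀ : Measure X))) :=
    ((ProbabilityMeasure.continuous_integral_continuousMap g₀).comp
      continuous_snd).continuousAt (x := (g₀, μ₀))
  have h2 : Tendsto (fun z : C(X, ℝ) × ProbabilityMeasure X =>
      ∫ x, (z.1 - g₀) x ∂(z.2 : Measure X)) (𝓝 (g₀, μ₀)) (𝓝 0) := by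
    have h3 : Tendsto (fun z : C(X, ℝ) × ProbabilityMeasure X => ‖z.1 - g₀‖) (𝓝 (g₀, μ₀))
        (𝓝 0) := by
      have : Continuous fun z : C(X, ℝ) × ProbabilityMeasure X => ‖z.1 - g₀‖ := by fun_prop
      simpa using this.continuousAt (x := (g₀, μ₀)) |>.tendsto
    refine squeeze_zero_norm (fun z => ?_) h3
    simpa using norm_integral_le_of_norm_le_const (μ := (z.2 : Measure X))
      (ae_of_all _ (z.1 - g₀).norm_coe_le_norm)
  have h4 := h1.add h2
  rw [add_zero] at h4
  refine h4.congr fun z => ?_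
  rw [← integral_add (hint _ _) (hint _ _)]
  congr 1
  ext x
  simp

/-- Currying turns joint continuity into continuity of `t ↦ f t` into `C(X, ℝ)`, which reduces the
claim to the preceding lemma. -/
lemma continuousOn_integral_probabilityMeasure {f : ℝ → X → ℝ}
    (hf : ContinuousOn (fun z : ℝ × X => f z.1 z.2) (Ioi 0 ×ˢ univ)) :
    ContinuousOn (fun z : ℝ × ProbabilityMeasure X => ∫ x, f z.1 x ∂(z.2 : Measure X))
      (Ioi 0 ×ˢ univ) := by
  let F : C(Ioi (0 : ℝ) × X, ℝ) := ⟨fun z => f z.1 z.2,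
    hf.comp_continuous (by fun_prop : Continuous fun z : Ioi (0 : ℝ) × X => ((z.1 : ℝ), z.2))
      fun z => ⟨z.1.2, mem_univ _⟩⟩
  rw [continuousOn_iff_continuous_domRestrict]
  have hc : Continuous fun z : (Ioi (0 : ℝ) ×ˢ univ : Set (ℝ × ProbabilityMeasure X)) =>
      (F.curry ⟨z.1.1, z.2.1⟩, z.1.2) := by
    refine Continuous.prodMk (F.curry.continuous.comp ?_) (by fun_prop)
    exact Continuous.subtype_mk (by fun_prop) _
  exact continuous_integral_continuousMap_probabilityMeasure.comp hc

/-- Compactness of `[t/2, 2t] × X` bounds `f'` by a constant, which dominates the differentiation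
under the integral. -/
lemma hasDerivAt_integral_of_continuousOn {f f' : ℝ → X → ℝ}
    (hf : ContinuousOn (fun z : ℝ × X => f z.1 z.2) (Ioi 0 ×ˢ univ))
    (hf' : ContinuousOn (fun z : ℝ × X => f' z.1 z.2) (Ioi 0 ×ˢ univ))
    (hd : ∀ t, 0 < t → ∀ x, HasDerivAt (fun s => f s x) (f' t x) t)
    (ρ : Measure X) [IsFiniteMeasure ρ] {t : ℝ} (ht : 0 < t) :
    HasDerivAt (fun s => ∫ x, f s x ∂ρ) (∫ x, f' t x ∂ρ) t := by
  have hcont : ∀ g : ℝ → X → ℝ, ContinuousOn (fun z : ℝ × X => g z.1 z.2) (Ioi 0 ×ˢ univ) →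
      ∀ s, 0 < s → Continuous (g s) := fun g hg s hs =>
    hg.comp_continuous (by fun_prop : Continuous fun x : X => (s, x)) fun x => ⟨hs, mem_univ _⟩
  have hsub : Icc (t / 2) (2 * t) ⊆ Ioi 0 := fun s hs => lt_of_lt_of_le (by positivity) hs.1
  obtain ⟨C, hC⟩ := (isCompact_Icc.prod isCompact_univ).exists_bound_of_continuousOn
    (hf'.mono (prod_mono hsub subset_rfl))
  have hint : Integrable (f t) ρ := by
    obtain ⟨M, hM⟩ := isCompact_univ.exists_bound_of_continuousOn (hcont f hf t ht).continuousOn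
    exact Integrable.of_bound (C := M) (hcont f hf t ht).measurable.aestronglyMeasurable
      (ae_of_all _ fun x => hM x (mem_univ _))
  refine (hasDerivAt_integral_of_dominated_loc_of_deriv_le (bound := fun _ => C)
    (Icc_mem_nhds (by linarith : t / 2 < t) (by linarith : t < 2 * t)) ?_ hint
    (hcont f' hf' t ht).measurable.aestronglyMeasurable
    (ae_of_all _ fun x s hs => hC (s, x) ⟨hs, mem_univ _⟩) (integrable_const C)
    (ae_of_all _ fun x s hs => hd s (hsub hs) x)).2
  filter_upwards [Ioi_mem_nhds ht] with s hs
  exact (hcont f hf s hs).measurable.aestronglyMeasurable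

/-- By monotone convergence the functional is a supremum of weakly continuous ones. -/
lemma lowerSemicontinuous_lintegral_iSup {k : X → ℝ≥0∞} {g : ℕ → C(X, NNReal)}
    (hg : Monotone g) (hk : ∀ x, k x = ⨆ i, (g i x : ℝ≥0∞)) :
    LowerSemicontinuous fun μ : ProbabilityMeasure X => ∫⁻ x, k x ∂(μ : Measure X) := by
  have e : (fun μ : ProbabilityMeasure X => ∫⁻ x, k x ∂(μ : Measure X)) =
      fun μ : ProbabilityMeasure X => ⨆ i, ∫⁻ x, (g i x : ℝ≥0∞) ∂(μ : Measure X) := by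
    ext μ
    simp_rw [hk]
    refine lintegral_iSup (fun i => ((g i).continuous.measurable).coe_nnreal_ennreal) ?_
    intro i j hij x
    exact ENNReal.coe_le_coe.2 (hg hij x)
  rw [e]
  exact lowerSemicontinuous_iSup fun i =>
    (ProbabilityMeasure.continuous_lintegral_continuousMap (g i)).lowerSemicontinuous

end CompactParam

/-! ### Splitting an extended-real integral -/

section EReal

/-- The extended integral of `r + h` for `r ≥ 0` and integrable `h`. -/
lemma lintegral_toENNReal_sub_lintegral_neg {Z : Type*} [MeasurableSpace Z] {ρ : Measure Z}
    {r : Z → ℝ≥0∞} {h : Z → ℝ} (hr : Measurable r) (hm : Measurable h)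
    (hi : Integrable h ρ) :
    ((∫⁻ z, ((r z : EReal) + (h z : EReal)).toENNReal ∂ρ : ℝ≥0∞) : EReal) -
      ((∫⁻ z, (-((r z : EReal) + (h z : EReal))).toENNReal ∂ρ : ℝ≥0∞) : EReal) =
      ((∫⁻ z, r z ∂ρ : ℝ≥0∞) : EReal) + ((∫ z, h z ∂ρ : ℝ) : EReal) := by
  -- The identity `(r+h)⁺ + h⁻ = (r+h)⁻ + r + h⁺` avoids subtraction, so it survives `r = ∞` and can
  -- be integrated in `ℝ≥0∞`; the bound `(r+h)⁻ ≤ h⁻` makes the negative part finite.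
  have hpt : ∀ z, ((r z : EReal) + (h z : EReal)).toENNReal + ENNReal.ofReal (-h z) =
      (-((r z : EReal) + (h z : EReal))).toENNReal + (r z + ENNReal.ofReal (h z)) ∧
      (-((r z : EReal) + (h z : EReal))).toENNReal ≤ ENNReal.ofReal (-h z) := by
    intro z
    induction r z with
    | top => simp
    | coe a =>
      have e1 : (((a : ℝ≥0∞) : EReal) + (h z : EReal)) = (((a : ℝ) + h z : ℝ) : EReal) := by
        rw [EReal.coe_add]; rfl
      have ha : max (a : ℝ) 0 = a := max_eq_left a.2
      rw [e1, ← EReal.coe_neg, EReal.toENNReal_of_ne_top (EReal.coe_ne_top _),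
        EReal.toENNReal_of_ne_top (EReal.coe_ne_top _), EReal.toReal_coe, EReal.toReal_coe,
        ← ENNReal.ofReal_coe_nnreal (p := a)]
      constructor
      · rw [ENNReal.ofReal, ENNReal.ofReal, ENNReal.ofReal, ENNReal.ofReal, ENNReal.ofReal]
        norm_cast
        rw [← NNReal.coe_inj]
        push_cast [Real.coe_toNNReal']
        rcases max_cases (h z) 0 with h1 | h1 <;> rcases max_cases (-h z) 0 with h2 | h2 <;>
          rcases max_cases ((a : ℝ) + h z) 0 with h3 | h3 <;>
          rcases max_cases (-((a : ℝ) + h z)) 0 with h4 | h4 <;> linarith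
      · exact ENNReal.ofReal_le_ofReal (by linarith [a.coe_nonneg])
  have hB : ∫⁻ z, ENNReal.ofReal (-h z) ∂ρ ≠ ⊤ := hi.neg.lintegral_lt_top.ne
  have hA : ∫⁻ z, ENNReal.ofReal (h z) ∂ρ ≠ ⊤ := hi.lintegral_lt_top.ne
  have hN : ∫⁻ z, (-((r z : EReal) + (h z : EReal))).toENNReal ∂ρ ≠ ⊤ :=
    ne_top_of_le_ne_top hB (lintegral_mono fun z => (hpt z).2)
  have hrh : Measurable fun z => r z + ENNReal.ofReal (h z) := hr.add hm.ennreal_ofReal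
  have hsum := lintegral_congr (μ := ρ) fun z => (hpt z).1
  rw [lintegral_add_right _ (Measurable.ennreal_ofReal (f := fun z => -h z) hm.neg), lintegral_add_right _
    hrh, lintegral_add_right _ hm.ennreal_ofReal] at hsum
  rw [integral_eq_lintegral_pos_part_sub_lintegral_neg_part hi]
  generalize (∫⁻ z, ((r z : EReal) + (h z : EReal)).toENNReal ∂ρ) = P at *
  generalize (∫⁻ z, (-((r z : EReal) + (h z : EReal))).toENNReal ∂ρ) = N at *
  generalize (∫⁻ z, ENNReal.ofReal (-h z) ∂ρ) = B at *
  generalize (∫⁻ z, ENNReal.ofReal (h z) ∂ρ) = A at *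
  generalize (∫⁻ z, r z ∂ρ) = R at *
  lift N to NNReal using hN
  lift B to NNReal using hB
  lift A to NNReal using hA
  induction R with
  | top =>
    have hP : P = ⊤ := by simpa using hsum
    subst hP
    have : ((N : ℝ≥0∞) : EReal) = ((N : ℝ) : EReal) := rfl
    rw [this, EReal.coe_ennreal_top, EReal.top_sub_coe, EReal.top_add_coe]
  | coe R =>
    have hP : P ≠ ⊤ := by
      rintro rfl
      rw [top_add] at hsum
      exact absurd hsum.symm (by simp [ENNReal.add_eq_top])
    lift P to NNReal using hP
    have hs : (P : ℝ) + B = N + (R + A) := by exact_mod_cast hsum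
    have e : ∀ a : NNReal, ((a : ℝ≥0∞) : EReal) = ((a : ℝ) : EReal) := fun _ => rfl
    rw [e, e, e, ← EReal.coe_sub, ← EReal.coe_add, EReal.coe_eq_coe_iff]
    simp only [ENNReal.coe_toReal]
    linarith

end EReal

/-! ### Mutual energies and uniqueness of the minimizer -/

section Parts

variable {n : ℕ}

/-- The mutual Riesz energy of two measures. -/
def mutualRiesz (q : ℝ) (μ ν : Measure (Space n)) : ℝ≥0∞ :=
  ∫⁻ z, shiftedRiesz (q / 2) 0 z ∂(μ.prod ν)

/-- The mutual energy of two measures for the kernel of the images. -/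
def mutualImage (q t : ℝ) (μ ν : Measure (Space n)) : ℝ :=
  ∫ z, imageProfile q t (‖z.1 - z.2‖ ^ 2) ∂(μ.prod ν)

lemma rieszKernel_eq_shiftedRiesz (q : ℝ) (x y : Space n) :
    rieszKernel q x y = shiftedRiesz (q / 2) 0 (x, y) := by
  rw [rieszKernel, shiftedRiesz, add_zero, edist_dist, dist_eq_norm,
    ENNReal.ofReal_pow (norm_nonneg _), ← ENNReal.rpow_natCast, ← ENNReal.rpow_mul]
  congr 1
  push_cast
  ring

lemma rieszKernel_ne_top {q : ℝ} {x y : Space n} (hxy : x ≠ y) : rieszKernel q x y ≠ ⊤ := by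
  rw [rieszKernel]
  exact ENNReal.rpow_ne_top_of_ne_zero (by simpa using hxy) (edist_ne_top x y)

lemma stripKernel_of_ne {q t : ℝ} (hq : 1 ≤ q) (ht : 0 < t) {x y : Space n} (hxy : x ≠ y) :
    stripKernel q t x y =
      (((rieszKernel q x y).toReal + imageProfile q t (dist x y ^ 2) : ℝ) : EReal) := by
  have h := rieszKernel_ne_top (q := q) hxy
  rw [stripKernel_eq hq ht, EReal.coe_add]
  lift rieszKernel q x y to NNReal using h with a
  rfl

lemma hasDerivAt_stripKernel {q t : ℝ} (hq : 1 ≤ q) (ht : 0 < t) {x y : Space n} (hxy : x ≠ y) :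
    HasDerivAt (fun s : ℝ => (stripKernel q s x y).toReal)
      (imageProfileDeriv q t (dist x y ^ 2)) t := by
  refine ((hasDerivAt_imageProfile hq ht (sq_nonneg (dist x y))).const_add
    (rieszKernel q x y).toReal).congr_of_eventuallyEq ?_
  filter_upwards [Ioi_mem_nhds ht] with s hs
  rw [stripKernel_of_ne hq hs hxy, EReal.toReal_coe]

lemma continuous_comp_dist {g : ℝ → ℝ → ℝ}
    (hg : ContinuousOn (fun p : ℝ × ℝ => g p.1 p.2) (Ioi 0 ×ˢ Ici 0)) {t : ℝ} (ht : 0 < t) :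
    Continuous fun z : Space n × Space n => g t (‖z.1 - z.2‖ ^ 2) :=
  hg.comp_continuous (by fun_prop : Continuous fun z : Space n × Space n =>
    (t, ‖z.1 - z.2‖ ^ 2)) fun z => ⟨ht, mem_Ici.2 (sq_nonneg _)⟩

variable {K : Set (Space n)} {μ ν : Measure (Space n)}

lemma integrable_prod_of_continuous [IsFiniteMeasure μ] [IsFiniteMeasure ν] (hK : IsCompact K)
    (hμ : μ Kᶜ = 0) (hν : ν Kᶜ = 0) {f : Space n × Space n → ℝ} (hf : Continuous f) :
    Integrable f (μ.prod ν) := by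
  have h0 : ∀ᵐ z ∂(μ.prod ν), z ∈ K ×ˢ K := by
    rw [ae_iff]
    change (μ.prod ν) (K ×ˢ K)ᶜ = 0
    rw [compl_prod_eq_union]
    exact measure_union_null (by simp [hμ]) (by simp [hν])
  have := hf.continuousOn.integrableOn_compact (μ := μ.prod ν) (hK.prod hK)
  rwa [IntegrableOn, Measure.restrict_eq_self_of_ae_mem h0] at this

lemma integrable_imageProfile [IsFiniteMeasure μ] [IsFiniteMeasure ν] (hK : IsCompact K)
    (hμ : μ Kᶜ = 0) (hν : ν Kᶜ = 0) {q t : ℝ} (hq : 1 ≤ q) (ht : 0 < t) :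
    Integrable (fun z => imageProfile q t (‖z.1 - z.2‖ ^ 2)) (μ.prod ν) :=
  integrable_prod_of_continuous hK hμ hν (continuous_comp_dist (continuousOn_imageProfile hq) ht)

/-- The profile is continuous, hence integrable for measures on the compact `K`; only the Riesz part
can be infinite, so the sum splits. -/
lemma doubleIntegral_stripKernel [IsFiniteMeasure μ] (hK : IsCompact K) (hμ : μ Kᶜ = 0)
    {q t : ℝ} (hq : 1 ≤ q) (ht : 0 < t) :
    doubleIntegral (stripKernel q t) μ = (mutualRiesz q μ μ : EReal) + mutualImage q t μ μ := by
  have hk : ∀ x y : Space n, stripKernel q t x y = (shiftedRiesz (q / 2) 0 (x, y) : EReal) +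
      (imageProfile q t (‖x - y‖ ^ 2) : ℝ) := fun x y => by
    rw [stripKernel_eq hq ht, rieszKernel_eq_shiftedRiesz, dist_eq_norm]
  have hm : Measurable fun z : Space n × Space n => imageProfile q t (‖z.1 - z.2‖ ^ 2) :=
    (continuous_comp_dist (continuousOn_imageProfile hq) ht).measurable
  have hkm : Measurable fun z : Space n × Space n => (shiftedRiesz (q / 2) 0 z : EReal) +
      (imageProfile q t (‖z.1 - z.2‖ ^ 2) : ℝ) :=
    (measurable_shiftedRiesz (q / 2) 0).coe_ereal_ennreal.add hm.coe_real_ereal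
  have hkn : Measurable fun z : Space n × Space n => -((shiftedRiesz (q / 2) 0 z : EReal) +
      (imageProfile q t (‖z.1 - z.2‖ ^ 2) : ℝ)) :=
    (continuous_neg : Continuous fun a : EReal => -a).measurable.comp hkm
  rw [doubleIntegral]
  simp_rw [hk]
  rw [mutualRiesz, mutualImage, ← lintegral_toENNReal_sub_lintegral_neg
    (measurable_shiftedRiesz (q / 2) 0) hm (integrable_imageProfile hK hμ hμ hq ht),
    lintegral_prod _ hkm.ereal_toENNReal.aemeasurable,
    lintegral_prod _ hkn.ereal_toENNReal.aemeasurable]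

lemma mutualRiesz_comm [SFinite μ] [SFinite ν] (q : ℝ) : mutualRiesz q μ ν = mutualRiesz q ν μ := by
  rw [mutualRiesz, ← lintegral_prod_swap, mutualRiesz]
  refine lintegral_congr fun z => ?_
  simp [shiftedRiesz, norm_sub_rev]

lemma mutualImage_comm [SFinite μ] [SFinite ν] (q t : ℝ) :
    mutualImage q t μ ν = mutualImage q t ν μ := by
  rw [mutualImage, ← integral_prod_swap, mutualImage]
  congr 1
  ext z
  simp [norm_sub_rev]

/-- The average of two measures. -/
def midMeasure (μ ν : Measure (Space n)) : Measure (Space n) := (2⁻¹ : NNReal) • (μ + ν)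

instance [IsProbabilityMeasure μ] [IsProbabilityMeasure ν] :
    IsProbabilityMeasure (midMeasure μ ν) := by
  constructor
  rw [midMeasure, Measure.smul_apply, Measure.add_apply, measure_univ, measure_univ, one_add_one_eq_two,
    ENNReal.smul_def, ENNReal.coe_inv two_ne_zero, smul_eq_mul]
  exact ENNReal.inv_mul_cancel two_ne_zero ENNReal.ofNat_ne_top

lemma midMeasure_prod_self [IsFiniteMeasure μ] [IsFiniteMeasure ν] :
    (midMeasure μ ν).prod (midMeasure μ ν) =
      (4⁻¹ : NNReal) • ((μ.prod μ + μ.prod ν) + (ν.prod μ + ν.prod ν)) := by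
  have : ∀ ρ σ : Measure (Space n), ∀ [IsFiniteMeasure ρ] [IsFiniteMeasure σ],
      ρ.prod ((2⁻¹ : NNReal) • σ) = (2⁻¹ : NNReal) • ρ.prod σ := by
    intro ρ σ _ _
    exact Measure.prod_smul_right _
  rw [midMeasure, Measure.prod_smul_left, this, smul_smul, Measure.add_prod, Measure.prod_add,
    Measure.prod_add]
  congr 1
  norm_num [← mul_inv]

lemma mutualRiesz_midMeasure [IsFiniteMeasure μ] [IsFiniteMeasure ν] (q : ℝ) :
    mutualRiesz q (midMeasure μ ν) (midMeasure μ ν) =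
      (4⁻¹ : NNReal) • (mutualRiesz q μ μ + mutualRiesz q ν ν + 2 * mutualRiesz q μ ν) := by
  rw [mutualRiesz, midMeasure_prod_self, lintegral_smul_measure, lintegral_add_measure,
    lintegral_add_measure, lintegral_add_measure]
  change (4⁻¹ : NNReal) • (mutualRiesz q μ μ + mutualRiesz q μ ν +
    (mutualRiesz q ν μ + mutualRiesz q ν ν)) = _
  rw [mutualRiesz_comm (μ := ν) (ν := μ)]
  congr 1
  ring

lemma mutualImage_midMeasure [IsFiniteMeasure μ] [IsFiniteMeasure ν] (hK : IsCompact K)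
    (hμ : μ Kᶜ = 0) (hν : ν Kᶜ = 0) {q t : ℝ} (hq : 1 ≤ q) (ht : 0 < t) :
    mutualImage q t (midMeasure μ ν) (midMeasure μ ν) =
      4⁻¹ * (mutualImage q t μ μ + mutualImage q t ν ν + 2 * mutualImage q t μ ν) := by
  have i1 := integrable_imageProfile hK hμ hμ hq ht
  have i2 := integrable_imageProfile hK hμ hν hq ht
  have i3 := integrable_imageProfile hK hν hμ hq ht
  have i4 := integrable_imageProfile hK hν hν hq ht
  rw [mutualImage, midMeasure_prod_self, integral_smul_nnreal_measure,
    integral_add_measure (i1.add_measure i2) (i3.add_measure i4), integral_add_measure i1 i2,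
    integral_add_measure i3 i4]
  change (4⁻¹ : NNReal) • (mutualImage q t μ μ + mutualImage q t μ ν +
    (mutualImage q t ν μ + mutualImage q t ν ν)) = _
  rw [mutualImage_comm (μ := ν) (ν := μ), NNReal.smul_def, smul_eq_mul]
  push_cast
  ring

lemma two_mul_mutualImage_le [IsProbabilityMeasure μ] [IsProbabilityMeasure ν] (hK : IsCompact K)
    (hμ : μ Kᶜ = 0) (hν : ν Kᶜ = 0) {q t : ℝ} (hq : 1 ≤ q) (ht : 0 < t) :
    2 * mutualImage q t μ ν ≤ mutualImage q t μ μ + mutualImage q t ν ν := by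
  have hc : Continuous fun z : Space n × Space n => imageSeries q (‖z.1 - z.2‖ ^ 2 / t ^ 2) := by
    refine (continuousOn_imageSeries hq).comp_continuous (by fun_prop) fun z => ?_
    have : 0 ≤ ‖z.1 - z.2‖ ^ 2 / t ^ 2 := by positivity
    exact mem_Ioi.2 (by linarith)
  exact two_mul_integral_imageProfile_le μ ν hq ht
    (integrable_prod_of_continuous hK hμ hν hc) (integrable_prod_of_continuous hK hμ hμ hc)
    (integrable_prod_of_continuous hK hν hν hc)

/-- The strip energy has at most one minimizer. -/
lemma eq_of_minimal [IsProbabilityMeasure μ] [IsProbabilityMeasure ν] (hK : IsCompact K)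
    (hμ : μ Kᶜ = 0) (hν : ν Kᶜ = 0) {q t : ℝ} (hq : 1 ≤ q) (ht : 0 < t)
    (hμt : mutualRiesz q μ μ ≠ ⊤) (hνt : mutualRiesz q ν ν ≠ ⊤) {E : ℝ}
    (hE : ∀ ρ : Measure (Space n), IsProbabilityMeasure ρ → ρ Kᶜ = 0 → mutualRiesz q ρ ρ ≠ ⊤ →
      E ≤ (mutualRiesz q ρ ρ).toReal + mutualImage q t ρ ρ)
    (hμE : (mutualRiesz q μ μ).toReal + mutualImage q t μ μ ≤ E)
    (hνE : (mutualRiesz q ν ν).toReal + mutualImage q t ν ν ≤ E) : μ = ν := by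
  have hp : 0 < q / 2 := by linarith
  have h2 : 2 * mutualRiesz q μ ν ≤ mutualRiesz q μ μ + mutualRiesz q ν ν :=
    two_mul_lintegral_shiftedRiesz_le μ ν hp le_rfl
  have hadd := ENNReal.add_ne_top.2 ⟨hμt, hνt⟩
  have h2t : 2 * mutualRiesz q μ ν ≠ ⊤ := ne_top_of_le_ne_top hadd h2
  have hsup : midMeasure μ ν Kᶜ = 0 := by simp [midMeasure, hμ, hν]
  have hav := mutualRiesz_midMeasure (μ := μ) (ν := ν) q
  rw [ENNReal.smul_def, smul_eq_mul] at hav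
  have havt : mutualRiesz q (midMeasure μ ν) (midMeasure μ ν) ≠ ⊤ := by
    rw [hav]
    exact ENNReal.mul_ne_top ENNReal.coe_ne_top (ENNReal.add_ne_top.2 ⟨hadd, h2t⟩)
  -- Minimality at the midpoint forces twice the mutual strip energy to be at least the sum of the
  -- two self-energies. The image part obeys the opposite inequality `hI`, so the Riesz part must
  -- satisfy the equality case of strict positive definiteness.
  have hmin := hE _ inferInstance hsup havt
  rw [hav, mutualImage_midMeasure hK hμ hν hq ht, ENNReal.toReal_mul, ENNReal.toReal_add hadd h2t,
    ENNReal.toReal_add hμt hνt, ENNReal.coe_toReal] at hmin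
  push_cast at hmin
  have hI := two_mul_mutualImage_le hK hμ hν hq ht
  refine eq_of_lintegral_shiftedRiesz_le μ ν hp le_rfl hμt hνt ?_
  change mutualRiesz q μ μ + mutualRiesz q ν ν ≤ 2 * mutualRiesz q μ ν
  rw [← ENNReal.toReal_le_toReal hadd h2t, ENNReal.toReal_add hμt hνt]
  linarith

/-- A kernel with finite integral is finite almost everywhere, and the Riesz kernel is `∞` on the
diagonal. -/
lemma prod_diagonal_eq_zero [SFinite μ] {q : ℝ} (hq : 1 ≤ q) (h : mutualRiesz q μ μ ≠ ⊤) :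
    (μ.prod μ) {p : Space n × Space n | p.1 = p.2} = 0 := by
  have hae := ae_lt_top (measurable_shiftedRiesz (q / 2) 0) h
  refine measure_mono_null (fun z hz => ?_) (ae_iff.1 hae)
  have hz' : z.1 = z.2 := hz
  simp only [mem_ofPred_eq, shiftedRiesz, hz', sub_self, norm_zero]
  rw [show ((0 : ℝ) ^ 2 + 0) = 0 by ring, ENNReal.ofReal_zero,
    ENNReal.zero_rpow_of_neg (by linarith)]
  simp

end Parts

/-! ### Transfer to the compact space of probability measures on `K` -/

section Supported

variable {n : ℕ} {K : Set (Space n)}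

/-- The extension by zero to `ℝⁿ` of a measure on `K`. -/
def zeroExtension (ν : ProbabilityMeasure K) : Measure (Space n) :=
  (ν : Measure K).map Subtype.val

instance (ν : ProbabilityMeasure K) : IsProbabilityMeasure (zeroExtension ν) :=
  Measure.isProbabilityMeasure_map measurable_subtype_coe.aemeasurable

lemma zeroExtension_compl (hK : MeasurableSet K) (ν : ProbabilityMeasure K) : zeroExtension ν Kᶜ = 0 := by
  rw [zeroExtension, Measure.map_apply measurable_subtype_coe hK.compl]
  simp

lemma exists_zeroExtension_eq (hK : MeasurableSet K) {μ : Measure (Space n)} [IsProbabilityMeasure μ]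
    (hμ : μ Kᶜ = 0) : ∃ ν : ProbabilityMeasure K, zeroExtension ν = μ := by
  have h : (μ.comap (Subtype.val : K → Space n)).map Subtype.val = μ := by
    rw [map_comap_subtype_coe hK]
    exact Measure.restrict_eq_self_of_ae_mem (by rw [ae_iff]; exact hμ)
  have hp : IsProbabilityMeasure (μ.comap (Subtype.val : K → Space n)) := by
    constructor
    rw [← preimage_univ (f := (Subtype.val : K → Space n)),
      ← Measure.map_apply measurable_subtype_coe MeasurableSet.univ, h, measure_univ]
  exact ⟨⟨_, hp⟩, h⟩

lemma zeroExtension_injective (hK : MeasurableSet K) :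
    Function.Injective (zeroExtension : ProbabilityMeasure K → Measure (Space n)) := by
  intro ν ν' h
  have he := MeasurableEmbedding.subtype_coe hK
  apply Subtype.ext
  have := congrArg (Measure.comap (Subtype.val : K → Space n)) h
  rwa [zeroExtension, zeroExtension, he.comap_map, he.comap_map] at this

lemma zeroExtension_prod_zeroExtension (ν : ProbabilityMeasure K) :
    (zeroExtension ν).prod (zeroExtension ν) =
      ((ν.prod ν : ProbabilityMeasure (K × K)) : Measure (K × K)).map
        (Prod.map Subtype.val Subtype.val) := by
  rw [zeroExtension, Measure.map_prod_map _ _ measurable_subtype_coe measurable_subtype_coe]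
  rfl

lemma measurableEmbedding_prodMap_val (hK : MeasurableSet K) :
    MeasurableEmbedding (Prod.map Subtype.val Subtype.val : K × K → Space n × Space n) :=
  (MeasurableEmbedding.subtype_coe hK).prodMap (MeasurableEmbedding.subtype_coe hK)

lemma integral_zeroExtension_prod (hK : MeasurableSet K) (ν : ProbabilityMeasure K)
    (f : Space n × Space n → ℝ) :
    ∫ z, f z ∂((zeroExtension ν).prod (zeroExtension ν)) =
      ∫ z : K × K, f (z.1, z.2) ∂((ν.prod ν : ProbabilityMeasure (K × K)) : Measure (K × K)) := by
  rw [zeroExtension_prod_zeroExtension, (measurableEmbedding_prodMap_val hK).integral_map]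
  rfl

lemma lintegral_zeroExtension_prod (hK : MeasurableSet K) (ν : ProbabilityMeasure K)
    (f : Space n × Space n → ℝ≥0∞) :
    ∫⁻ z, f z ∂((zeroExtension ν).prod (zeroExtension ν)) =
      ∫⁻ z : K × K, f (z.1, z.2) ∂((ν.prod ν : ProbabilityMeasure (K × K)) : Measure (K × K)) := by
  rw [zeroExtension_prod_zeroExtension, (measurableEmbedding_prodMap_val hK).lintegral_map]
  rfl

lemma continuous_prod_self [CompactSpace K] :
    Continuous fun ν : ProbabilityMeasure K => ν.prod ν :=
  ProbabilityMeasure.continuous_prod.comp (continuous_id.prodMk continuous_id)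

open Filter Topology in
-- The shifts `1/(i+1)` decrease to `0`, so the regularized kernels increase to the singular one,
-- including the value `∞` on the diagonal.
lemma shiftedRiesz_eq_iSup {p : ℝ} (hp : 0 < p) (z : Space n × Space n) :
    shiftedRiesz p 0 z =
      ⨆ i : ℕ, ((Real.toNNReal ((‖z.1 - z.2‖ ^ 2 + 1 / ((i : ℝ) + 1)) ^ (-p)) : NNReal) : ℝ≥0∞) := by
  have hmono : Monotone fun i : ℕ =>
      ((Real.toNNReal ((‖z.1 - z.2‖ ^ 2 + 1 / ((i : ℝ) + 1)) ^ (-p)) : NNReal) : ℝ≥0∞) := by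
    intro i j hij
    refine ENNReal.coe_le_coe.2 (Real.toNNReal_le_toNNReal ?_)
    refine Real.rpow_le_rpow_of_nonpos (by positivity) ?_ (by linarith)
    have : (1 : ℝ) / ((j : ℝ) + 1) ≤ 1 / ((i : ℝ) + 1) := Nat.one_div_le_one_div hij
    linarith
  refine tendsto_nhds_unique ?_ (tendsto_atTop_iSup hmono)
  have h1 : Tendsto (fun i : ℕ => ‖z.1 - z.2‖ ^ 2 + 1 / ((i : ℝ) + 1)) atTop
      (𝓝 (‖z.1 - z.2‖ ^ 2 + 0)) :=
    tendsto_one_div_add_atTop_nhds_zero_nat.const_add _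
  have h2 := (ENNReal.continuous_rpow_const (y := -p)).continuousAt.tendsto.comp
    (ENNReal.tendsto_ofReal h1)
  refine h2.congr fun i => ?_
  simp only [Function.comp]
  rw [ENNReal.ofReal_rpow_of_pos (by positivity)]
  rfl

/-- The Riesz kernel is an increasing limit of continuous kernels on `K × K`, and `ν ↦ ν ⊗ ν` is
weakly continuous. -/
lemma lowerSemicontinuous_mutualRiesz (hK : IsCompact K) {q : ℝ} (hq : 1 ≤ q) :
    LowerSemicontinuous fun ν : ProbabilityMeasure K => mutualRiesz q (zeroExtension ν) (zeroExtension ν) := by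
  have : CompactSpace K := isCompact_iff_compactSpace.1 hK
  let g : ℕ → C(K × K, NNReal) := fun i =>
    ⟨fun z => Real.toNNReal ((‖(z.1 : Space n) - z.2‖ ^ 2 + 1 / ((i : ℝ) + 1)) ^ (-(q / 2))),
      continuous_real_toNNReal.comp
        (Continuous.rpow_const (by fun_prop) fun z => Or.inl (by positivity))⟩
  have hg : Monotone g := by
    intro i j hij z
    refine Real.toNNReal_le_toNNReal ?_
    refine Real.rpow_le_rpow_of_nonpos (by positivity) ?_ (by linarith)
    have : (1 : ℝ) / ((j : ℝ) + 1) ≤ 1 / ((i : ℝ) + 1) := Nat.one_div_le_one_div hij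
    linarith
  have h := lowerSemicontinuous_lintegral_iSup (X := K × K)
    (k := fun z => shiftedRiesz (q / 2) 0 ((z.1 : Space n), (z.2 : Space n))) hg
    fun z => shiftedRiesz_eq_iSup (by linarith) _
  have h2 := h.comp continuous_prod_self
  convert! h2 using 2 with ν
  exact lintegral_zeroExtension_prod hK.measurableSet ν _

lemma continuousOn_pair_comp {g : ℝ → ℝ → ℝ}
    (hg : ContinuousOn (fun p : ℝ × ℝ => g p.1 p.2) (Ioi 0 ×ˢ Ici 0)) :
    ContinuousOn (fun z : ℝ × (K × K) => g z.1 (‖(z.2.1 : Space n) - z.2.2‖ ^ 2))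
      (Ioi 0 ×ˢ univ) :=
  hg.comp (f := fun z : ℝ × (K × K) => (z.1, ‖(z.2.1 : Space n) - z.2.2‖ ^ 2)) (by fun_prop)
    fun _ hz => ⟨hz.1, mem_Ici.2 (sq_nonneg _)⟩

lemma continuousOn_integral_zeroExtension (hK : IsCompact K) {g : ℝ → ℝ → ℝ}
    (hg : ContinuousOn (fun p : ℝ × ℝ => g p.1 p.2) (Ioi 0 ×ˢ Ici 0)) :
    ContinuousOn (fun z : ℝ × ProbabilityMeasure K =>
      ∫ w, g z.1 (‖w.1 - w.2‖ ^ 2) ∂((zeroExtension z.2).prod (zeroExtension z.2))) (Ioi 0 ×ˢ univ) := by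
  have : CompactSpace K := isCompact_iff_compactSpace.1 hK
  have h := continuousOn_integral_probabilityMeasure
    (f := fun t (w : K × K) => g t (‖(w.1 : Space n) - w.2‖ ^ 2)) (continuousOn_pair_comp hg)
  have h2 := h.comp (f := fun z : ℝ × ProbabilityMeasure K => (z.1, z.2.prod z.2))
    (s := Ioi 0 ×ˢ univ)
    (continuous_fst.prodMk (continuous_prod_self.comp continuous_snd)).continuousOn
    fun _ hz => ⟨hz.1, mem_univ _⟩
  refine h2.congr fun z _ => ?_
  exact integral_zeroExtension_prod hK.measurableSet z.2 _

lemma hasDerivAt_mutualImage (hK : IsCompact K) {q t : ℝ} (hq : 1 ≤ q) (ht : 0 < t)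
    (ν : ProbabilityMeasure K) :
    HasDerivAt (fun s => mutualImage q s (zeroExtension ν) (zeroExtension ν))
      (∫ w, imageProfileDeriv q t (‖w.1 - w.2‖ ^ 2) ∂((zeroExtension ν).prod (zeroExtension ν))) t := by
  have : CompactSpace K := isCompact_iff_compactSpace.1 hK
  have h := hasDerivAt_integral_of_continuousOn
    (f := fun s (z : K × K) => imageProfile q s (‖(z.1 : Space n) - z.2‖ ^ 2))
    (f' := fun s (z : K × K) => imageProfileDeriv q s (‖(z.1 : Space n) - z.2‖ ^ 2))
    (continuousOn_pair_comp (K := K) (continuousOn_imageProfile hq))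
    (continuousOn_pair_comp (K := K) (continuousOn_imageProfileDeriv hq))
    (fun s hs x => hasDerivAt_imageProfile hq hs (sq_nonneg _))
    ((ν.prod ν : ProbabilityMeasure (K × K)) : Measure (K × K)) ht
  rw [integral_zeroExtension_prod hK.measurableSet]
  refine h.congr_of_eventuallyEq (Filter.Eventually.of_forall fun s => ?_)
  exact integral_zeroExtension_prod hK.measurableSet ν _

end Supported

/-! ### The strip energy as a minimum, and the theorem -/

section Main

variable {n : ℕ} {K : Set (Space n)} {q : ℝ}

lemma exists_mutualRiesz_ne_top (hK : MeasurableSet K) (hV : rieszEnergy q K < ⊤) :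
    ∃ ν : ProbabilityMeasure K, mutualRiesz q (zeroExtension ν) (zeroExtension ν) ≠ ⊤ := by
  simp only [rieszEnergy, iInf_lt_iff] at hV
  obtain ⟨μ, hμp, hμ, h⟩ := hV
  obtain ⟨ν, rfl⟩ := exists_zeroExtension_eq hK hμ
  refine ⟨ν, ?_⟩
  rw [mutualRiesz, lintegral_prod _ (measurable_shiftedRiesz _ _).aemeasurable]
  simp_rw [rieszKernel_eq_shiftedRiesz] at h
  exact h.ne

/-- The strip energy in terms of a minimizer among the measures of finite Riesz energy. -/
lemma stripEnergy_eq (hK : IsCompact K) (hq : 1 ≤ q) {t : ℝ} (ht : 0 < t)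
    {ν : ProbabilityMeasure K} (hν : mutualRiesz q (zeroExtension ν) (zeroExtension ν) ≠ ⊤)
    (hmin : ∀ ν' : ProbabilityMeasure K, mutualRiesz q (zeroExtension ν') (zeroExtension ν') ≠ ⊤ →
      (mutualRiesz q (zeroExtension ν) (zeroExtension ν)).toReal + mutualImage q t (zeroExtension ν) (zeroExtension ν) ≤
        (mutualRiesz q (zeroExtension ν') (zeroExtension ν')).toReal +
          mutualImage q t (zeroExtension ν') (zeroExtension ν')) :
    stripEnergy q K t = (((mutualRiesz q (zeroExtension ν) (zeroExtension ν)).toReal +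
      mutualImage q t (zeroExtension ν) (zeroExtension ν) : ℝ) : EReal) := by
  have hfin : ∀ ν' : ProbabilityMeasure K, mutualRiesz q (zeroExtension ν') (zeroExtension ν') ≠ ⊤ →
      doubleIntegral (stripKernel q t) (zeroExtension ν') =
        (((mutualRiesz q (zeroExtension ν') (zeroExtension ν')).toReal +
          mutualImage q t (zeroExtension ν') (zeroExtension ν') : ℝ) : EReal) := by
    intro ν' h
    rw [doubleIntegral_stripKernel hK (zeroExtension_compl hK.measurableSet ν') hq ht, EReal.coe_add]
    lift mutualRiesz q (zeroExtension ν') (zeroExtension ν') to NNReal using h with a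
    rfl
  apply le_antisymm
  · rw [← hfin ν hν]
    exact iInf_le_of_le _ (iInf_le_of_le inferInstance
      (iInf_le_of_le (zeroExtension_compl hK.measurableSet ν) le_rfl))
  · refine le_iInf fun μ => le_iInf fun _ => le_iInf fun hμ => ?_
    obtain ⟨ν', rfl⟩ := exists_zeroExtension_eq hK.measurableSet hμ
    -- The image part is real, so infinite Riesz energy means infinite strip energy and such
    -- measures do not compete.
    by_cases h : mutualRiesz q (zeroExtension ν') (zeroExtension ν') = ⊤
    · rw [doubleIntegral_stripKernel hK hμ hq ht, h, EReal.coe_ennreal_top, EReal.top_add_coe]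
      exact le_top
    · rw [hfin ν' h]
      exact EReal.coe_le_coe_iff.2 (hmin ν' h)

end Main

end

theorem theorem3p4 (n : ℕ) (q : ℝ) (hq1 : 1 ≤ q) (hqn : q < (n : ℝ))
    (K : Set (Space n)) (hK : IsCompact K) (hV : rieszEnergy q K < ⊤) :
    -- `E_K(t)` is finite
    (∀ t : ℝ, 0 < t → stripEnergy q K t ≠ ⊥ ∧ stripEnergy q K t ≠ ⊤) ∧
    -- the equilibrium measure exists and is unique
    (∀ t : ℝ, 0 < t → ∃! μ : Measure (Space n), IsStripEquilibrium q K t μ) ∧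
    -- `E_K` is continuously differentiable
    ContDiffOn ℝ 1 (fun t : ℝ => (stripEnergy q K t).toReal) (Ioi 0) ∧
    -- the kernel is finite and differentiable in `t` off the diagonal
    (∀ t : ℝ, 0 < t → ∀ x y : Space n, x ≠ y →
      stripKernel q t x y ≠ ⊥ ∧ stripKernel q t x y ≠ ⊤ ∧
      DifferentiableAt ℝ (fun s : ℝ => (stripKernel q s x y).toReal) t) ∧
    -- the derivative formula, with the well-definedness of its right-hand side
    (∀ t : ℝ, 0 < t → ∀ μ : Measure (Space n), IsStripEquilibrium q K t μ →
      (μ.prod μ) {p : Space n × Space n | p.1 = p.2} = 0 ∧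
      Integrable (fun p : Space n × Space n => stripKernelDeriv q t p.1 p.2) (μ.prod μ) ∧
      HasDerivAt (fun s : ℝ => (stripEnergy q K s).toReal)
        (∫ x, ∫ y, stripKernelDeriv q t x y ∂μ ∂μ) t) := by
  have hKm := hK.measurableSet
  have : CompactSpace K := isCompact_iff_compactSpace.1 hK
  set R : ProbabilityMeasure K → ℝ≥0∞ := fun ν => mutualRiesz q (zeroExtension ν) (zeroExtension ν)
  set H : ℝ → ProbabilityMeasure K → ℝ := fun t ν => mutualImage q t (zeroExtension ν) (zeroExtension ν)
  set H' : ℝ → ProbabilityMeasure K → ℝ := fun t ν =>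
    ∫ w, imageProfileDeriv q t (‖w.1 - w.2‖ ^ 2) ∂((zeroExtension ν).prod (zeroExtension ν)) with hH'
  have hRlsc : LowerSemicontinuous R := lowerSemicontinuous_mutualRiesz hK hq1
  have hHc : ContinuousOn (fun z : ℝ × ProbabilityMeasure K => H z.1 z.2) (Ioi 0 ×ˢ univ) :=
    continuousOn_integral_zeroExtension hK (continuousOn_imageProfile hq1)
  have hHc' : ContinuousOn (fun z : ℝ × ProbabilityMeasure K => H' z.1 z.2) (Ioi 0 ×ˢ univ) :=
    continuousOn_integral_zeroExtension hK (continuousOn_imageProfileDeriv hq1)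
  have hHd : ∀ t, 0 < t → ∀ ν, HasDerivAt (fun s => H s ν) (H' t ν) t := fun t ht ν =>
    hasDerivAt_mutualImage hK hq1 ht ν
  have hne : ∃ ν, R ν ≠ ⊤ := exists_mutualRiesz_ne_top hKm hV
  -- Stated for every real `t` so that choice yields a total function `m`; its values for `t ≤ 0`
  -- are irrelevant.
  have hex : ∀ t : ℝ, ∃ ν, 0 < t → R ν ≠ ⊤ ∧
      ∀ ν', R ν' ≠ ⊤ → (R ν).toReal + H t ν ≤ (R ν').toReal + H t ν' := by
    intro t
    by_cases ht : 0 < t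
    · obtain ⟨ν, h⟩ := exists_minimizer hRlsc hne (h := H t)
        (hHc.comp_continuous (by fun_prop : Continuous fun ν : ProbabilityMeasure K => (t, ν))
          fun ν => ⟨ht, mem_univ _⟩)
      exact ⟨ν, fun _ => h⟩
    · exact ⟨hne.choose, fun h => absurd h ht⟩
  choose m hm using hex
  have hfin : ∀ t, 0 < t → R (m t) ≠ ⊤ := fun t ht => (hm t ht).1
  have hmin := fun t ht => (hm t ht).2
  have hE : ∀ t, 0 < t → stripEnergy q K t = (((R (m t)).toReal + H t (m t) : ℝ) : EReal) :=
    fun t ht => stripEnergy_eq hK hq1 ht (hfin t ht) (hmin t ht)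
  have huniq : ∀ t, 0 < t → ∀ ν, R ν ≠ ⊤ →
      (R ν).toReal + H t ν ≤ (R (m t)).toReal + H t (m t) → ν = m t := by
    intro t ht ν hν hle
    refine zeroExtension_injective hKm (eq_of_minimal hK (zeroExtension_compl hKm ν) (zeroExtension_compl hKm _) hq1 ht
      hν (hfin t ht) (fun ρ _ hρ hρt => ?_) hle le_rfl)
    obtain ⟨ν', rfl⟩ := exists_zeroExtension_eq hKm hρ
    exact hmin t ht ν' hρt
  have hmc : ∀ t, 0 < t → ContinuousAt m t := fun t ht =>
    continuousAt_argmin hRlsc hHc hfin hmin huniq ht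
  have hderiv : ∀ t, 0 < t →
      HasDerivAt (fun s : ℝ => (stripEnergy q K s).toReal) (H' t (m t)) t := by
    intro t ht
    refine (hasDerivAt_min_value hHc' hHd hfin hmin ht (hmc t ht)).congr_of_eventuallyEq ?_
    filter_upwards [Ioi_mem_nhds ht] with s hs
    rw [hE s hs, EReal.toReal_coe]
  have heq : ∀ t, 0 < t → ∀ μ, IsStripEquilibrium q K t μ → μ = zeroExtension (m t) := by
    intro t ht μ hμ
    have := hμ.isProbabilityMeasure
    obtain ⟨ν, rfl⟩ := exists_zeroExtension_eq hKm hμ.measure_compl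
    have h := hμ.attains
    rw [doubleIntegral_stripKernel hK hμ.measure_compl hq1 ht, hE t ht] at h
    -- The attained minimum is a real number, which excludes infinite Riesz energy.
    have hν : R ν ≠ ⊤ := by
      intro htop
      rw [show mutualRiesz q (zeroExtension ν) (zeroExtension ν) = ⊤ from htop, EReal.coe_ennreal_top,
        EReal.top_add_coe] at h
      exact EReal.coe_ne_top _ h.symm
    have hcoe : (mutualRiesz q (zeroExtension ν) (zeroExtension ν) : EReal) = ((R ν).toReal : EReal) := by
      change ((R ν : ℝ≥0∞) : EReal) = _
      lift R ν to NNReal using hν with a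
      rfl
    rw [hcoe, ← EReal.coe_add, EReal.coe_eq_coe_iff] at h
    rw [huniq t ht ν hν h.le]
  have heqm : ∀ t, 0 < t → IsStripEquilibrium q K t (zeroExtension (m t)) := by
    intro t ht
    refine ⟨inferInstance, zeroExtension_compl hKm _, ?_⟩
    rw [doubleIntegral_stripKernel hK (zeroExtension_compl hKm _) hq1 ht, hE t ht, EReal.coe_add]
    have hf := hfin t ht
    change ((R (m t) : ℝ≥0∞) : EReal) + _ = _
    lift R (m t) to NNReal using hf with a
    rfl
  refine ⟨fun t ht => ?_, fun t ht => ⟨_, heqm t ht, heq t ht⟩, ?_, fun t ht x y hxy => ?_,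
    fun t ht μ hμ => ?_⟩
  · rw [hE t ht]
    exact ⟨EReal.coe_ne_bot _, EReal.coe_ne_top _⟩
  · rw [contDiffOn_one_iff_derivWithin (uniqueDiffOn_Ioi 0)]
    refine ⟨fun t ht => (hderiv t ht).differentiableAt.differentiableWithinAt, ?_⟩
    -- The derivative is continuous because `H'` is jointly continuous and `m` is continuous.
    refine ContinuousOn.congr (f := fun t => H' t (m t)) (fun t ht => ?_) fun t ht =>
      (hderiv t ht).hasDerivWithinAt.derivWithin (uniqueDiffOn_Ioi 0 t ht)
    have h1 : ContinuousAt (fun z : ℝ × ProbabilityMeasure K => H' z.1 z.2) (t, m t) :=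
      hHc'.continuousAt ((isOpen_Ioi.prod isOpen_univ).mem_nhds ⟨ht, mem_univ _⟩)
    exact (ContinuousAt.comp (f := fun s => (s, m s)) h1
      (continuousAt_id.prodMk (hmc t ht))).continuousWithinAt
  · rw [stripKernel_of_ne hq1 ht hxy]
    exact ⟨EReal.coe_ne_bot _, EReal.coe_ne_top _,
      (hasDerivAt_stripKernel hq1 ht hxy).differentiableAt⟩
  · obtain rfl := heq t ht μ hμ
    have hdiag := prod_diagonal_eq_zero hq1 (hfin t ht)
    -- Off the null diagonal the Riesz term is finite and constant in `t`, so only the profile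
    -- contributes to the derivative.
    have hae : (fun w : Space n × Space n => imageProfileDeriv q t (‖w.1 - w.2‖ ^ 2))
        =ᵐ[(zeroExtension (m t)).prod (zeroExtension (m t))] fun p => stripKernelDeriv q t p.1 p.2 := by
      have hoff : ∀ᵐ p ∂((zeroExtension (m t)).prod (zeroExtension (m t))), p.1 ≠ p.2 := by
        rw [ae_iff]
        simpa using hdiag
      filter_upwards [hoff] with p hp
      rw [stripKernelDeriv, (hasDerivAt_stripKernel hq1 ht hp).deriv, dist_eq_norm]
    have hint : Integrable (fun p : Space n × Space n => stripKernelDeriv q t p.1 p.2)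
        ((zeroExtension (m t)).prod (zeroExtension (m t))) :=
      (integrable_prod_of_continuous hK (zeroExtension_compl hKm _) (zeroExtension_compl hKm _)
        (continuous_comp_dist (continuousOn_imageProfileDeriv hq1) ht)).congr hae
    refine ⟨hdiag, hint, ?_⟩
    have := hderiv t ht
    rw [hH'] at this
    simp only at this
    rwa [integral_congr_ae hae, integral_prod _ hint] at this
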